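/- **Setting.** Let $\sigma\in\{-1,+1\}$ and let $r$ be an integer with $r\ge 1$ if $\sigma=-1$ and $r\ge 3$ if $\sigma=+1$. Put $D=r^2-4\sigma$, $\lambda=\frac{r+\sqrt D}{2}>1$, $\overline\lambda=\frac{r-\sqrt D}{2}$, and let $T=T_{r,\sigma}$ be the automorphism of $\mathbb T^2=\mathbb R^2/\mathbb Z^2$ given by the companion matrix $C_{r,\sigma}=\begin{pmatrix} r&1\\-\sigma&0\end{pmatrix}$. Let $\widetilde{\mathfrak X}$ be the additive semigroup of all two-sided sequences $\varepsilon=(\varepsilon_n)_{n\in\mathbb Z}$ of nonnegative integers for which $\sum_{n\ge1}\varepsilon_n\lambda^{-n}$ and $\sum_{n\ge1}\varepsilon_{-n}\lambda^{-n}$ converge, with coordinatewise addition, the topology of coordinatewise convergence and the shift $(\tau\varepsilon)_n=\varepsilon_{n+1}$. An *arithmetic coding* of $T$ is a pair $(\varphi,\mathfrak X)$ in which $\varphi:\widetilde{\mathfrak X}\to\mathbb T^2$ is an additive map with $\varphi\tau=T\varphi$ that is continuous on $\{\varepsilon:\varepsilon_n\le w_n\ \forall n\in\mathbb Z\}$ for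 every $w\in\widetilde{\mathfrak X}$, and $\mathfrak X\subset\widetilde{\mathfrak X}$ is closed, shift-invariant ($\tau\varepsilon\in\mathfrak X\iff\varepsilon\in\mathfrak X$) and such that 1. $\mathfrak X$ is total: if $\varepsilon\in\mathfrak X$, $\varepsilon'\in\widetilde{\mathfrak X}$ and, for some $N\in\mathbb Z$, every tail $(\varepsilon'_k,\varepsilon'_{k+1},\dots)$, $k\in\mathbb Z$, is lexicographically (strictly) less than $(\varepsilon_N,\varepsilon_{N+1},\dots)$, then $\varepsilon'\in\mathfrak X$; 2. $\varphi(\mathfrak X)=\mathbb T^2$, and $\varphi$ is one-to-one on the set of those elements of $\mathfrak X$ that have only finitely many nonzero coordinates. It is a *bijective arithmetic coding* (BAC) if in addition Lebesgue-almost every point of $\mathbb T^2$ has exactly one preimage under $\varphi|_{\mathfrak X}$. A map $\varphi$ on $\widetilde{\mathfrak X}$ is called a BAC if $(\varphi,\mathfrak X)$ is a BAC for some $\mathfrak X$. For $\xi\in\mathbb R$ let $$L_\xi(\varepsilon)=\Bigl(\sum_{n=-\infty}^{\infty}\varepsilon_n\lambda^{-n}\Bigr)\begin{pmatrix}\xi\\-\sigma\xi\lambda^{-1}\end{pmatrix}\bmod\mathbb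 Z^2:=\lim_{N\to\infty}\Bigl[\Bigl(\sum_{n=-N}^{N}\varepsilon_n\lambda^{-n}\Bigr)\begin{pmatrix}\xi\\-\sigma\xi\lambda^{-1}\end{pmatrix}\bmod\mathbb Z^2\Bigr],\qquad \varepsilon\in\widetilde{\mathfrak X},$$ whenever these limits in $\mathbb T^2$ exist. The symbolic compactum $\mathfrak X_{r,\sigma}$ is, for $\sigma=-1$, the set of sequences with $0\le\varepsilon_n\le r$ and $\varepsilon_n=r\Rightarrow\varepsilon_{n+1}=0$; for $\sigma=+1$, the set of sequences with $0\le\varepsilon_n\le r-1$ that contain no block $(r-1)(r-2)^j(r-1)$, $j\ge0$. **Theorem 2.2.** (a) $T_{r,\sigma}$ admits a bijective arithmetic coding. (b) If $(r,\sigma)\ne(3,+1)$, a map $\varphi:\widetilde{\mathfrak X}\to\mathbb T^2$ is a BAC of $T_{r,\sigma}$ if and only if $\varphi=L_\xi$ with $\xi=\dfrac{\pm\lambda^k}{\sqrt D}$ for some $k\in\mathbb Z$ and some choice of the sign. (c) If $(r,\sigma)=(3,+1)$ (so $D=5$, $\lambda=\frac{3+\sqrt5}{2}$), a map $\varphi:\widetilde{\mathfrak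 X}\to\mathbb T^2$ is a BAC of $T_{3,+1}$ if and only if $\varphi=L_\xi$ with $\xi=\dfrac{\pm\theta^k}{\sqrt D}$ for some $k\in\mathbb Z$ and some choice of the sign, where $\theta=\sqrt\lambda=\frac{1+\sqrt5}{2}$. (d) For all $(m,n)\in\mathbb Z^2\setminus\{(0,0)\}$ and $\xi=\dfrac{m+n\lambda}{\sqrt D}$, the map $L_\xi$ is defined on $\widetilde{\mathfrak X}$, and its restriction to $\mathfrak X_{r,\sigma}$ is $K$-to-one over Lebesgue-almost every point of $\mathbb T^2$, where $K=|D\,N(\xi)|$, $N(\xi)=\xi\overline\xi$ and $\overline\xi=-\dfrac{m+n\overline\lambda}{\sqrt D}$. -/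

import Mathlib

open MeasureTheory Filter Topology

/-- The 2-torus `ℝ² / ℤ²`; its `volume` is the normalized Lebesgue measure. -/
abbrev Torus2 : Type := Fin 2 → UnitAddCircle

/-- The endomorphism of the torus given by an integer matrix
(an automorphism if the determinant is `±1`). -/
def toralMap (M : Matrix (Fin 2) (Fin 2) ℤ) (x : Torus2) : Torus2 :=
  fun i => ∑ j, M i j • x j

/-- The companion matrix with trace `r` and determinant `σ`. -/
def companionMatrix (r : ℕ) (σ : ℤ) : Matrix (Fin 2) (Fin 2) ℤ :=
  !![(r : ℤ), 1; -σ, 0]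

/-- The discriminant `D = r² - 4σ` of the characteristic polynomial `x² - r x + σ`. -/
def discrD (M : Matrix (Fin 2) (Fin 2) ℤ) : ℝ :=
  (M.trace : ℝ) ^ 2 - 4 * (M.det : ℝ)

/-- The eigenvalue `λ = (r + √D) / 2`. -/
noncomputable def eigenLam (M : Matrix (Fin 2) (Fin 2) ℤ) : ℝ :=
  ((M.trace : ℝ) + Real.sqrt (discrD M)) / 2

/-- The algebraic conjugate `(r - √D) / 2` of `λ`. -/
noncomputable def eigenLamConj (M : Matrix (Fin 2) (Fin 2) ℤ) : ℝ :=
  ((M.trace : ℝ) - Real.sqrt (discrD M)) / 2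

/-- The primary symbolic set: the semigroup of all two-sided sequences `ε` of nonnegative integers
such that `∑_{n ≥ 1} ε_n λ^{-n}` and `∑_{n ≥ 1} ε_{-n} λ^{-n}` converge. It carries the topology
of coordinatewise convergence (as a subspace of the product of discrete spaces). -/
def PrimarySet (lam : ℝ) : AddSubmonoid (ℤ → ℕ) where
  carrier := {ε | Summable (fun n : ℕ => (ε ((n : ℤ) + 1) : ℝ) / lam ^ (n + 1)) ∧
    Summable (fun n : ℕ => (ε (-((n : ℤ) + 1)) : ℝ) / lam ^ (n + 1))}
  zero_mem' := by
    constructor <;> simp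
  add_mem' := by
    rintro a b ⟨ha, ha'⟩ ⟨hb, hb'⟩
    constructor
    · refine (ha.add hb).congr fun n => ?_
      simp [add_div]
    · refine (ha'.add hb').congr fun n => ?_
      simp [add_div]

theorem shift_mem {lam : ℝ} (ε : PrimarySet lam) :
    (fun n : ℤ => ε.1 (n + 1)) ∈ PrimarySet lam := by
  obtain ⟨ε, h1, h2⟩ := ε
  by_cases hl : lam = 0
  · subst hl
    constructor <;> simp
  constructor
  · have h := ((summable_nat_add_iff 1).2 h1).mul_right lam
    refine h.congr fun n => ?_
    push_cast
    rw [pow_succ lam (n + 1)]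
    field_simp
  · refine (summable_nat_add_iff 1).1 ?_
    refine (h2.div_const lam).congr fun n => ?_
    have e : -(((n + 1 : ℕ) : ℤ) + 1) + 1 = -((n : ℤ) + 1) := by push_cast; ring
    simp only [e]
    rw [pow_succ lam (n + 1), div_div]

/-- The two-sided shift `(τ ε)_n = ε_{n+1}`. -/
def shift {lam : ℝ} (ε : PrimarySet lam) : PrimarySet lam :=
  ⟨fun n : ℤ => ε.1 (n + 1), shift_mem ε⟩

/-- The (strict) lexicographic order on one-sided sequences. -/
def LexLess (a b : ℕ → ℕ) : Prop :=
  ∃ n, a n < b n ∧ ∀ m < n, a m = b m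

/-- `X` is total: if `ε ∈ X` and all one-sided tails of `ε'` are lexicographically less than one
fixed tail `(ε_N, ε_{N+1}, …)` of `ε`, then `ε' ∈ X`. -/
def IsTotalSet {lam : ℝ} (X : Set (PrimarySet lam)) : Prop :=
  ∀ ε ∈ X, ∀ ε' : PrimarySet lam,
    (∃ N : ℤ, ∀ k : ℤ,
      LexLess (fun j : ℕ => ε'.1 (k + (j : ℤ))) (fun j : ℕ => ε.1 (N + (j : ℤ)))) → ε' ∈ X

/-- `(φ, X)` is an arithmetic coding of the hyperbolic automorphism of the torus given by `M`.
Continuity of `φ` is with respect to coordinatewise convergence on each set of sequences that is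
dominated by a member of the primary symbolic set. -/
structure IsArithmeticCoding (M : Matrix (Fin 2) (Fin 2) ℤ)
    (φ : PrimarySet (eigenLam M) → Torus2) (X : Set (PrimarySet (eigenLam M))) : Prop where
  map_add : ∀ ε ε', φ (ε + ε') = φ ε + φ ε'
  continuousOn : ∀ w : PrimarySet (eigenLam M), ContinuousOn φ {ε | ∀ n, ε.1 n ≤ w.1 n}
  map_shift : ∀ ε, φ (shift ε) = toralMap M (φ ε)
  isClosed : IsClosed X
  shift_invariant : ∀ ε, shift ε ∈ X ↔ ε ∈ X
  total : IsTotalSet X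
  surjective : φ '' X = Set.univ
  injOn_finite : Set.InjOn φ {ε | ε ∈ X ∧ (Function.support ε.1).Finite}

/-- A bijective arithmetic coding: `φ` restricted to `X` is one-to-one over Lebesgue-almost every
point of the torus. -/
def IsBijectiveArithmeticCoding (M : Matrix (Fin 2) (Fin 2) ℤ)
    (φ : PrimarySet (eigenLam M) → Torus2) (X : Set (PrimarySet (eigenLam M))) : Prop :=
  IsArithmeticCoding M φ X ∧ ∀ᵐ x ∂(volume : Measure Torus2), ∃! ε, ε ∈ X ∧ φ ε = x

/-- `φ = L_ξ`, that is, for every `ε` the limit of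
`(∑_{|n| ≤ N} ε_n λ^{-n}) • (ξ, -σ ξ λ⁻¹) mod ℤ²` as `N → ∞` exists and equals `φ ε`. -/
def IsLMap (r : ℕ) (σ : ℤ) (ξ : ℝ)
    (φ : PrimarySet (eigenLam (companionMatrix r σ)) → Torus2) : Prop :=
  ∀ ε, Tendsto
    (fun N : ℕ => fun i : Fin 2 =>
      (((∑ n ∈ Finset.Icc (-(N : ℤ)) N,
          (ε.1 n : ℝ) * eigenLam (companionMatrix r σ) ^ (-n)) *
        (![ξ, -(σ : ℝ) * ξ * (eigenLam (companionMatrix r σ))⁻¹] i) : ℝ) : UnitAddCircle))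
    atTop (𝓝 (φ ε))

/-- The symbolic compactum. For `σ = -1`: digits `0, …, r`, and a digit `r` is followed by `0`.
For `σ = 1`: digits `0, …, r - 1`, and no block `(r-1) (r-2) … (r-2) (r-1)` occurs, with any
number `j ≥ 0` of digits `r - 2` in the middle. -/
def symbolicCompactum (lam : ℝ) (r : ℕ) (σ : ℤ) : Set (PrimarySet lam) :=
  {ε | (σ = -1 → ∀ n : ℤ, ε.1 n ≤ r ∧ (ε.1 n = r → ε.1 (n + 1) = 0)) ∧
    (σ = 1 → (∀ n : ℤ, ε.1 n + 1 ≤ r) ∧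
      ∀ (n : ℤ) (j : ℕ), ¬ (ε.1 n + 1 = r ∧
        (∀ i : ℕ, 1 ≤ i → i ≤ j → ε.1 (n + (i : ℤ)) + 2 = r) ∧
        ε.1 (n + (j : ℤ) + 1) + 1 = r))}

/-! Write c for the conjugate of λ. In coordinates along the expanding and contracting eigenvectors
(`leaf`) the torus is the plane modulo the lattice of pairs (x, x̄) with x in ℤ[λ], and T multiplies
the two coordinates by λ and c. Modulo this lattice, a digit at a place ≤ 0 can be moved from the
expanding to the contracting coordinate. So L_ξ with ξ = (m + nλ)/√D is the convergent expression
`coding`, with coordinates (m + nλ)·`fut` and −(m + nc)·`past`. It equals `coding` with parameters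
1, 0 followed by multiplication by m + nλ on the torus.

Almost everywhere bijectivity for the parameter 1: a two-state automaton recognizing the compactum
confines (`fut`, −`past`) to two rectangles whose areas add up to λ − c, exactly the covolume of the
lattice. Greedy expansions show that the compact image of the compactum contains a dense half-leaf,
so it is the whole torus (`coding_surjOn`). Hence lattice translates of the rectangles cover the
plane, and the equality of areas forbids overlaps of positive measure. Outside countably many lines
`fut` and `past` determine the digits (`eq_of_fut_past`). Counting fibres of multiplication by m +
nλ (`ncard_fiber`) turns this into the |N(m + nλ)|-to-one statement.

Classification: an additive, equivariant and continuous φ is determined by its value at a single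
digit. That value is homoclinic to 0, so it lies on both leaves through 0 and comes from some m + nλ
(`exists_eq_coding`). Totality and injectivity on finite sequences, played against the carry rule T²
− rT + σ = 0, force X into the compactum up to sequences with null image. The image of X ∩ compactum
under the parameter 1 is then closed and T-invariant, and by Baire it has interior, because finitely
many of its translates cover the torus; expansion along dense leaves makes it everything. A single
point with one preimage now forces |N(m + nλ)| = 1 (`norm_eq_one_of_bijective`). The units of ℤ[λ]
are ±λ^k, except when λ is the square of the golden ratio. -/

/-! ### The ring ℤ[l] and its units -/

/-- `l > 1` and `c` are the roots of `x² - r x + σ`, where `r ≥ 1` if `σ = -1` and `r ≥ 3` if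
`σ = 1`, and `l` is irrational. -/
structure QuadUnit (r : ℕ) (σ : ℤ) (l c : ℝ) : Prop where
  cases : (σ = -1 ∧ 1 ≤ r) ∨ (σ = 1 ∧ 3 ≤ r)
  one_lt : 1 < l
  add_eq : l + c = r
  mul_eq : l * c = σ
  irrational : Irrational l

namespace QuadUnit

theorem of_sqrt {r : ℕ} {σ : ℤ} (h : (σ = -1 ∧ 1 ≤ r) ∨ (σ = 1 ∧ 3 ≤ r)) :
    QuadUnit r σ ((r + √((r : ℝ) ^ 2 - 4 * σ)) / 2) ((r - √((r : ℝ) ^ 2 - 4 * σ)) / 2) := by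
  have hD : (0 : ℤ) ≤ (r : ℤ) ^ 2 - 4 * σ := by
    rcases h with ⟨rfl, h⟩ | ⟨rfl, h⟩ <;> nlinarith
  have hDR : (0 : ℝ) ≤ (r : ℝ) ^ 2 - 4 * σ := by exact_mod_cast hD
  have hs := Real.sq_sqrt hDR
  have hs0 := Real.sqrt_nonneg ((r : ℝ) ^ 2 - 4 * σ)
  have hirr : Irrational √((r : ℝ) ^ 2 - 4 * σ) := by
    have := (irrational_sqrt_intCast_iff_of_nonneg hD).2 ?_
    · simpa using this
    rintro ⟨a, ha⟩
    obtain ⟨b, hb0, hb⟩ : ∃ b : ℤ, 0 ≤ b ∧ (r : ℤ) ^ 2 - 4 * σ = b * b :=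
      ⟨|a|, abs_nonneg a, by rw [ha, abs_mul_abs_self]⟩
    rcases h with ⟨rfl, h⟩ | ⟨rfl, h⟩
    -- The discriminant is not a square: r² + 4 lies strictly between r² and (r + 2)² and differs in
    -- parity from (r + 1)²; for r ≥ 3, r² − 4 lies strictly between (r − 1)² and r².
    · have h1 : (r : ℤ) < b := by nlinarith
      have h2 : b < (r : ℤ) + 2 := by nlinarith
      obtain rfl : b = r + 1 := by omega
      ring_nf at hb
      omega
    · have h1 : (r : ℤ) - 1 < b := by nlinarith
      have h2 : b < (r : ℤ) := by nlinarith
      omega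
  refine ⟨h, ?_, by ring, by linarith [hs, mul_self_nonneg (r : ℝ)], ?_⟩
  · generalize √((r : ℝ) ^ 2 - 4 * σ) = t at hs hs0
    rcases h with ⟨rfl, h⟩ | ⟨rfl, h⟩
    · have : (1 : ℝ) ≤ r := by exact_mod_cast h
      by_contra hle
      have := pow_le_pow_left₀ hs0 (show t ≤ 2 - r by linarith) 2
      push_cast at hs
      nlinarith
    · have : (3 : ℝ) ≤ r := by exact_mod_cast h
      linarith
  · have := (hirr.natCast_add r).div_natCast (m := 2) (by norm_num)
    simpa using this

variable {r : ℕ} {σ : ℤ} {l c : ℝ} (h : QuadUnit r σ l c)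
include h

theorem pos : 0 < l := by linarith [h.one_lt]

theorem sigma_sq : (σ : ℝ) ^ 2 = 1 := by
  rcases h.cases with ⟨rfl, _⟩ | ⟨rfl, _⟩ <;> norm_num

theorem conj_eq : c = σ / l := by
  rw [eq_div_iff h.pos.ne', mul_comm]; exact h.mul_eq

theorem abs_conj : |c| = 1 / l := by
  rw [h.conj_eq, abs_div, abs_of_pos h.pos]
  rcases h.cases with ⟨rfl, _⟩ | ⟨rfl, _⟩ <;> norm_num

theorem abs_conj_lt_one : |c| < 1 := by
  rw [h.abs_conj, div_lt_one h.pos]; exact h.one_lt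

theorem conj_lt : c < l := by
  have := (abs_lt.1 h.abs_conj_lt_one).2
  linarith [h.one_lt]

theorem sub_pos : 0 < l - c := by linarith [h.conj_lt]

theorem conj_ne_zero : c ≠ 0 := by
  have := h.abs_conj
  have h1 : 0 < 1 / l := by have := h.pos; positivity
  rintro rfl
  simp at this
  linarith [h.pos]

theorem sq_eq : l ^ 2 = r * l - σ := by
  rw [← h.mul_eq, ← h.add_eq]; ring

theorem conj_sq_eq : c ^ 2 = r * c - σ := by
  rw [← h.mul_eq, ← h.add_eq]; ring

theorem eq_zero_of_eq_zero {m n : ℤ} (hmn : (m : ℝ) + n * l = 0) : m = 0 ∧ n = 0 := by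
  by_cases hn : n = 0
  · subst hn; simpa using hmn
  · exact absurd hmn ((h.irrational.intCast_mul hn).intCast_add m).ne_zero

theorem int_inj {m n m' n' : ℤ} (hmn : (m : ℝ) + n * l = m' + n' * l) : m = m' ∧ n = n' := by
  have := h.eq_zero_of_eq_zero (m := m - m') (n := n - n') (by push_cast; linarith)
  omega

theorem conj_irrational : Irrational c := by
  have := h.irrational.natCast_sub r
  rwa [← h.add_eq, add_sub_cancel_left] at this

theorem conj_eq_zero_of_eq_zero {m n : ℤ} (hmn : (m : ℝ) + n * c = 0) : m = 0 ∧ n = 0 := by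
  by_cases hn : n = 0
  · subst hn; simpa using hmn
  · exact absurd hmn ((h.conj_irrational.intCast_mul hn).intCast_add m).ne_zero

theorem norm_eq (m n : ℤ) :
    ((m : ℝ) + n * l) * (m + n * c) = ((m * m + m * n * r + n * n * σ : ℤ) : ℝ) := by
  push_cast
  rw [← h.mul_eq, ← h.add_eq]; ring

/-- Powers of the unit `l` lie in `ℤ[l]` and have norm `±1`. -/
theorem zpow_mem (k : ℤ) : ∃ m n : ℤ, l ^ k = m + n * l ∧ c ^ k = m + n * c := by
  have hl := h.pos.ne'
  have hc := h.conj_ne_zero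
  have hσ := h.sigma_sq
  induction k with
  | zero => exact ⟨1, 0, by simp, by simp⟩
  | succ k ih =>
    obtain ⟨m, n, h1, h2⟩ := ih
    refine ⟨-n * σ, m + n * r, ?_, ?_⟩
    · rw [zpow_add_one₀ hl, h1]; push_cast; linear_combination n * h.sq_eq
    · rw [zpow_add_one₀ hc, h2]; push_cast; linear_combination n * h.conj_sq_eq
  | pred k ih =>
    obtain ⟨m, n, h1, h2⟩ := ih
    refine ⟨n + m * σ * r, -m * σ, ?_, ?_⟩
    · rw [zpow_sub_one₀ hl, h1, ← div_eq_mul_inv, div_eq_iff hl]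
      push_cast
      linear_combination (-m) * hσ + m * σ * h.sq_eq
    · rw [zpow_sub_one₀ hc, h2, ← div_eq_mul_inv, div_eq_iff hc]
      push_cast
      linear_combination (-m) * hσ + m * σ * h.conj_sq_eq

theorem abs_zpow_mul_conj (k : ℤ) : |l ^ k * c ^ k| = 1 := by
  rw [← mul_zpow, h.mul_eq]
  rcases h.cases with ⟨rfl, _⟩ | ⟨rfl, _⟩ <;> simp

/-- A unit of `ℤ[l]` in `[1, l)` equals `1`. -/
theorem unit_eq_one (hexc : ¬ (r = 3 ∧ σ = 1)) {m n : ℤ} (h1 : 1 ≤ (m : ℝ) + n * l)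
    (h2 : (m : ℝ) + n * l < l) (hN : |((m : ℝ) + n * l) * (m + n * c)| = 1) :
    (m : ℝ) + n * l = 1 := by
  set u := (m : ℝ) + n * l with hu
  set w := (m : ℝ) + n * c with hw
  have hnn : u - w = n * (l - c) := by rw [hu, hw]; ring
  have hs := h.sub_pos
  by_contra hne
  have h1 : 1 < u := lt_of_le_of_ne h1 (Ne.symm hne)
  have hu0 : 0 < u := by linarith
  have hl := h.pos
  -- The conjugate is w = ±1/u, so n(l − c) = u − w is u − 1/u or u + 1/u. Both functions increase
  -- on (1, ∞), which bounds n(l − c) in terms of l.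
  have key : u + u⁻¹ < l + l⁻¹ := by
    have : l + l⁻¹ - (u + u⁻¹) = (l - u) * (l * u - 1) / (l * u) := by field_simp; ring
    have : 0 < (l - u) * (l * u - 1) / (l * u) := by
      have : 1 < l * u := by nlinarith
      exact div_pos (mul_pos (by linarith) (by linarith)) (by positivity)
    linarith
  have key' : u - u⁻¹ < l - l⁻¹ := by
    have := inv_strictAnti₀ hu0 h2
    linarith
  have hui : u⁻¹ < 1 := inv_lt_one_of_one_lt₀ h1
  have hn0 : n ≠ 0 := by
    rintro rfl
    have e : w = u := by simp [hu, hw]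
    rw [e, abs_mul_self] at hN
    nlinarith
  have hcases : w = u⁻¹ ∨ w = -u⁻¹ := by
    rcases (abs_eq zero_le_one).1 hN with h3 | h3
    · left; field_simp; linarith
    · right; field_simp; linarith
  have hui0 : 0 < u⁻¹ := by positivity
  have hnpos : 1 ≤ n := by
    have : (0 : ℝ) < n * (l - c) := by rcases hcases with e | e <;> rw [← hnn, e] <;> linarith
    have : (0 : ℝ) < n := pos_of_mul_pos_left this hs.le
    exact_mod_cast this
  have hnR : (1 : ℝ) ≤ n := by exact_mod_cast hnpos
  have hle : l - c ≤ n * (l - c) := by nlinarith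
  have hcl : c = σ * l⁻¹ := by rw [h.conj_eq]; rfl
  rcases h.cases with ⟨hσ, hr⟩ | ⟨hσ, hr⟩
  · have : l - c = l + l⁻¹ := by rw [hcl, hσ]; push_cast; ring
    rcases hcases with e | e <;> rw [e] at hnn <;> linarith
  · have hc : c = l⁻¹ := by rw [hcl, hσ]; push_cast; ring
    have hmul := h.mul_eq
    have hadd := h.add_eq
    rcases hcases with e | e
    · rw [e] at hnn; rw [hc] at hle hnn; linarith
    -- The one case without an immediate contradiction: σ = 1 and a unit of norm −1. It forces n =
    -- 1, then m(m + r) = −2, and this leaves only r = 3.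
    · have hlt : n * (l - c) < l + c := by rw [← hnn, e, hc]; linarith
      have h4 : (n : ℝ) ^ 2 * ((r : ℝ) ^ 2 - 4) < (r : ℝ) ^ 2 := by
        have e1 : (l - c) ^ 2 = (r : ℝ) ^ 2 - 4 := by
          rw [← hadd]; rw [hσ] at hmul; push_cast at hmul; linear_combination (-4) * hmul
        rw [← e1, ← hadd, ← mul_pow]
        exact pow_lt_pow_left₀ hlt (by positivity) two_ne_zero
      have h5 : n ^ 2 * ((r : ℤ) ^ 2 - 4) < (r : ℤ) ^ 2 := by exact_mod_cast h4
      have hr3 : (3 : ℤ) ≤ r := by exact_mod_cast hr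
      have hn1 : n = 1 := by
        by_contra hn1
        have h6 : 2 ^ 2 ≤ n ^ 2 := pow_le_pow_left₀ (by norm_num) (by omega) 2
        have h7 : (3 : ℤ) ^ 2 ≤ (r : ℤ) ^ 2 := pow_le_pow_left₀ (by norm_num) hr3 2
        nlinarith [mul_le_mul_of_nonneg_right h6 (show (0 : ℤ) ≤ (r : ℤ) ^ 2 - 4 by linarith)]
      subst hn1
      have hmm : ((m : ℝ) + l) * (m + c) = -1 := by
        have e2 : (m : ℝ) + c = -u⁻¹ := by rw [← e, hw]; simp
        have e3 : (m : ℝ) + l = u := by rw [hu]; simp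
        rw [e2, e3]; field_simp
      have hmZ : m * m + m * r + 1 = -1 := by
        have : (m : ℝ) * m + m * r + 1 = -1 := by
          rw [hσ] at hmul; push_cast at hmul
          rw [← hmm, ← hadd]; linear_combination -hmul
        exact_mod_cast this
      have hdvd : m ∣ 2 := ⟨-(m + r), by linarith⟩
      have hm2 := Int.le_of_dvd (by norm_num) hdvd
      have hm2' := Int.le_of_dvd (by norm_num) (neg_dvd.2 hdvd)
      apply hexc
      refine ⟨?_, hσ⟩
      obtain rfl | rfl | rfl | rfl | rfl : m = -2 ∨ m = -1 ∨ m = 0 ∨ m = 1 ∨ m = 2 := by omega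
      all_goals omega

/-- The units of `ℤ[l]` are `±l^k`, except for `(r, σ) = (3, 1)`. -/
theorem unit_eq_zpow (hexc : ¬ (r = 3 ∧ σ = 1)) {m n : ℤ}
    (hN : |((m : ℝ) + n * l) * (m + n * c)| = 1) :
    ∃ (s : ℝ) (k : ℤ), (s = 1 ∨ s = -1) ∧ (m : ℝ) + n * l = s * l ^ k := by
  have hl := h.pos
  have hc := h.conj_ne_zero
  have hne : (m : ℝ) + n * l ≠ 0 := by
    intro e; rw [e] at hN; simp at hN
  obtain ⟨s, hs, a, b, ha, hb, hpos⟩ : ∃ s : ℝ, (s = 1 ∨ s = -1) ∧ ∃ a b : ℤ,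
      (m : ℝ) + n * l = s * (a + b * l) ∧ (m : ℝ) + n * c = s * (a + b * c) ∧
      0 < (a : ℝ) + b * l := by
    rcases lt_or_gt_of_ne hne with h0 | h0
    · refine ⟨-1, Or.inr rfl, -m, -n, ?_, ?_, ?_⟩ <;> push_cast <;> linarith
    · exact ⟨1, Or.inl rfl, m, n, by ring, by ring, h0⟩
  have hN' : |((a : ℝ) + b * l) * (a + b * c)| = 1 := by
    rw [ha, hb] at hN
    rw [← hN]; congr 1
    rcases hs with rfl | rfl <;> ring
  obtain ⟨k, hk1, hk2⟩ := exists_mem_Ico_zpow hpos h.one_lt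
  obtain ⟨m', n', e1, e2⟩ := h.zpow_mem (-k)
  have hkpos : 0 < l ^ (-k) := zpow_pos hl _
  have f1 : ((a * m' - b * n' * σ : ℤ) : ℝ) + ((a * n' + b * m' + b * n' * r : ℤ) : ℝ) * l
      = (a + b * l) * l ^ (-k) := by
    rw [e1]; push_cast; linear_combination (-b * n') * h.sq_eq
  have f2 : ((a * m' - b * n' * σ : ℤ) : ℝ) + ((a * n' + b * m' + b * n' * r : ℤ) : ℝ) * c
      = (a + b * c) * c ^ (-k) := by
    rw [e2]; push_cast; linear_combination (-b * n') * h.conj_sq_eq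
  have hk0 : 0 < l ^ k := zpow_pos hl k
  have := h.unit_eq_one hexc (m := a * m' - b * n' * σ) (n := a * n' + b * m' + b * n' * r)
    (by rw [f1, zpow_neg, ← div_eq_mul_inv, one_le_div hk0]; exact hk1)
    (by rw [f1, zpow_neg, ← div_eq_mul_inv, div_lt_iff₀ hk0, ← zpow_one_add₀ hl.ne', add_comm 1 k]
        exact hk2)
    (by rw [f1, f2, mul_mul_mul_comm, abs_mul, hN', h.abs_zpow_mul_conj, one_mul])
  refine ⟨s, k, hs, ?_⟩
  rw [f1, zpow_neg, ← div_eq_mul_inv, div_eq_one_iff_eq hk0.ne'] at this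
  rw [ha, this]

end QuadUnit

/-! ### Leaf coordinates on the torus -/

/-- The point of the torus with coordinates `p.1` along the expanding eigenvector `(1, -c)` and
`p.2` along the contracting eigenvector `-(1, -l)`, in units of `1 / (l - c)`. -/
noncomputable def leaf (l c : ℝ) : ℝ × ℝ →+ Torus2 where
  toFun p := ![(((p.1 - p.2) / (l - c) : ℝ) : UnitAddCircle),
    (((-c * p.1 + l * p.2) / (l - c) : ℝ) : UnitAddCircle)]
  map_zero' := by ext i; fin_cases i <;> simp
  map_add' p q := by
    ext i
    fin_cases i
    · simp only [Fin.zero_eta, Matrix.cons_val_zero, Pi.add_apply, ← AddCircle.coe_add]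
      congr 1; simp; ring
    · simp only [Fin.mk_one, Matrix.cons_val_one, Pi.add_apply, ← AddCircle.coe_add,
        Matrix.cons_val_zero]
      congr 1; simp; ring

theorem leaf_apply (l c : ℝ) (p : ℝ × ℝ) :
    leaf l c p = ![(((p.1 - p.2) / (l - c) : ℝ) : UnitAddCircle),
      (((-c * p.1 + l * p.2) / (l - c) : ℝ) : UnitAddCircle)] := rfl

theorem continuous_leaf (l c : ℝ) : Continuous (leaf l c) := by
  have h (f : ℝ × ℝ → ℝ) (hf : Continuous f) : Continuous fun p => (f p : UnitAddCircle) :=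
    (AddCircle.continuous_mk' 1).comp hf
  refine continuous_pi fun i => ?_
  fin_cases i
  · exact h _ (by fun_prop)
  · exact h _ (by fun_prop)

theorem toralMap_add (M : Matrix (Fin 2) (Fin 2) ℤ) (x y : Torus2) :
    toralMap M (x + y) = toralMap M x + toralMap M y := by
  ext i; simp [toralMap, smul_add]; abel

/-- `toralMap` as an endomorphism of the group `Torus2`. -/
def toralHom (M : Matrix (Fin 2) (Fin 2) ℤ) : Torus2 →+ Torus2 :=
  AddMonoidHom.mk' (toralMap M) (toralMap_add M)

theorem toralMap_coe (M : Matrix (Fin 2) (Fin 2) ℤ) (z : Fin 2 → ℝ) :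
    toralMap M (fun i => (z i : UnitAddCircle)) =
      fun i => ((∑ j, (M i j : ℝ) * z j : ℝ) : UnitAddCircle) := by
  ext i
  simp only [toralMap, Fin.sum_univ_two, ← AddCircle.coe_zsmul, ← AddCircle.coe_add, zsmul_eq_mul]

/-- The matrix `m + n C` where `C` is the companion matrix. -/
def mulMatrix (r : ℕ) (σ m n : ℤ) : Matrix (Fin 2) (Fin 2) ℤ :=
  !![m + n * r, n; -σ * n, m]

theorem companionMatrix_eq (r : ℕ) (σ : ℤ) : companionMatrix r σ = mulMatrix r σ 0 1 := by
  simp [companionMatrix, mulMatrix]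

namespace QuadUnit

variable {r : ℕ} {σ : ℤ} {l c : ℝ} (h : QuadUnit r σ l c)
include h

theorem leaf_eq_zero_iff (p : ℝ × ℝ) :
    leaf l c p = 0 ↔ ∃ m n : ℤ, p = ((m : ℝ) + n * l, (m : ℝ) + n * c) := by
  have hs := h.sub_pos.ne'
  constructor
  · intro h0
    have h1 := congrFun h0 0
    have h2 := congrFun h0 1
    simp only [leaf_apply, Matrix.cons_val_zero, Matrix.cons_val_one, Pi.zero_apply,
      AddCircle.coe_eq_zero_iff, zsmul_eq_mul, mul_one] at h1 h2
    obtain ⟨n, hn⟩ := h1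
    obtain ⟨m, hm⟩ := h2
    rw [eq_div_iff hs] at hn hm
    refine ⟨m, n, Prod.ext ?_ ?_⟩
    · refine mul_left_cancel₀ hs ?_
      simp only; linear_combination (-l) * hn - hm
    · refine mul_left_cancel₀ hs ?_
      simp only; linear_combination (-c) * hn - hm
  · rintro ⟨m, n, rfl⟩
    have h1 : ((m : ℝ) + n * l - (m + n * c)) / (l - c) = n := by field_simp; ring
    have h2 : (-c * ((m : ℝ) + n * l) + l * (m + n * c)) / (l - c) = m := by field_simp; ring
    ext i
    fin_cases i <;>
      simp only [leaf_apply, Fin.zero_eta, Fin.mk_one, Matrix.cons_val_zero, Matrix.cons_val_one,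
        Pi.zero_apply, h1, h2, AddCircle.coe_eq_zero_iff, zsmul_eq_mul, mul_one]
    exacts [⟨n, rfl⟩, ⟨m, rfl⟩]

theorem leaf_eq_iff (p q : ℝ × ℝ) :
    leaf l c p = leaf l c q ↔ ∃ m n : ℤ, p = q + ((m : ℝ) + n * l, (m : ℝ) + n * c) := by
  rw [← sub_eq_zero, ← map_sub, h.leaf_eq_zero_iff]
  simp only [sub_eq_iff_eq_add']

theorem leaf_surjective : Function.Surjective (leaf l c) := by
  intro t
  have hs := h.sub_pos.ne'
  obtain ⟨a, ha⟩ := QuotientAddGroup.mk_surjective (t 0)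
  obtain ⟨b, hb⟩ := QuotientAddGroup.mk_surjective (t 1)
  refine ⟨(l * a + b, c * a + b), ?_⟩
  have h1 : (l * a + b - (c * a + b)) / (l - c) = a := by field_simp; ring
  have h2 : (-c * (l * a + b) + l * (c * a + b)) / (l - c) = b := by field_simp; ring
  ext i
  fin_cases i
  · simp only [leaf_apply, Fin.zero_eta, Matrix.cons_val_zero, h1]; exact ha
  · simp only [leaf_apply, Fin.mk_one, Matrix.cons_val_one, h2]; exact hb

theorem toralMap_mulMatrix (m n : ℤ) (p : ℝ × ℝ) :
    toralMap (mulMatrix r σ m n) (leaf l c p) =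
      leaf l c (((m : ℝ) + n * l) * p.1, ((m : ℝ) + n * c) * p.2) := by
  have e : leaf l c p = fun i => ((![(p.1 - p.2) / (l - c),
      (-c * p.1 + l * p.2) / (l - c)] i : ℝ) : UnitAddCircle) := by
    ext i; fin_cases i <;> rfl
  rw [e, toralMap_coe]
  have hm := h.mul_eq
  have ha := h.add_eq
  ext i
  fin_cases i
  · simp only [leaf_apply, Fin.sum_univ_two, mulMatrix]
    simp only [Fin.zero_eta, Matrix.of_apply, Matrix.cons_val_zero, Matrix.cons_val_one]
    congr 1; push_cast; rw [← ha]; ring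
  · simp only [leaf_apply, Fin.sum_univ_two, mulMatrix]
    simp only [Fin.mk_one, Matrix.of_apply, Matrix.cons_val_zero, Matrix.cons_val_one]
    congr 1; push_cast; rw [← hm]; ring

theorem toralMap_companion (p : ℝ × ℝ) :
    toralMap (companionMatrix r σ) (leaf l c p) = leaf l c (l * p.1, c * p.2) := by
  rw [companionMatrix_eq, h.toralMap_mulMatrix]; simp

theorem iterate_toralMap_companion (k : ℕ) (p : ℝ × ℝ) :
    (toralMap (companionMatrix r σ))^[k] (leaf l c p) = leaf l c (l ^ k * p.1, c ^ k * p.2) := by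
  induction k with
  | zero => simp
  | succ k ih =>
    rw [Function.iterate_succ_apply', ih, h.toralMap_companion]
    congr 2 <;> (simp only; ring)

/-- The expanding half-leaf through `0` is dense. -/
theorem closure_halfLeaf : closure {t | ∃ x : ℝ, 0 ≤ x ∧ t = leaf l c (x, 0)} = Set.univ := by
  have hs := h.sub_pos
  have hd : DenseRange fun n : ℕ => n • ((-c : ℝ) : UnitAddCircle) :=
    denseRange_zsmul_iff_nsmul.1
      (AddCircle.denseRange_zsmul_coe_iff.2 (by simpa using h.conj_irrational))
  refine Set.eq_univ_of_forall fun t => ?_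
  obtain ⟨u, hu0, hu⟩ : ∃ u : ℝ, 0 ≤ u ∧ (u : UnitAddCircle) = t 0 := by
    obtain ⟨a, ha⟩ := QuotientAddGroup.mk_surjective (t 0)
    refine ⟨Int.fract a, Int.fract_nonneg a, ?_⟩
    rw [← ha]
    exact AddCircle.coe_fract a
  let g : UnitAddCircle → Torus2 := fun a => ![t 0, a - ((c * u : ℝ) : UnitAddCircle)]
  have hg : Continuous g := by
    refine continuous_pi fun i => ?_
    fin_cases i
    · exact continuous_const
    · exact continuous_id.sub continuous_const
  have ht : t = g (t 1 + ((c * u : ℝ) : UnitAddCircle)) := by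
    ext i; fin_cases i <;> simp [g]
  rw [ht]
  refine map_mem_closure hg (hd (t 1 + ((c * u : ℝ) : UnitAddCircle))) ?_
  rintro _ ⟨n, rfl⟩
  -- Raising `u` by the integer `n` fixes the first torus coordinate and moves the second by −nc.
  refine ⟨(l - c) * (u + n), by positivity, ?_⟩
  ext i
  fin_cases i
  · simp only [g, leaf_apply, Fin.zero_eta, Matrix.cons_val_zero, sub_zero, ← hu]
    rw [mul_div_cancel_left₀ _ hs.ne', AddCircle.coe_add,
      (AddCircle.coe_eq_zero_iff 1 (x := (n : ℝ))).2 ⟨(n : ℤ), by simp⟩, add_zero]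
  · simp only [g, leaf_apply, Fin.mk_one, Matrix.cons_val_one, ← AddCircle.coe_nsmul,
      ← AddCircle.coe_sub]
    rw [show (-c * ((l - c) * (u + n)) + l * 0) / (l - c) = n • (-c) - c * u by
      field_simp; simp; ring]

/-- A closed set with nonempty interior that is mapped into itself by the toral automorphism is
the whole torus. -/
theorem eq_univ_of_interior {F : Set Torus2} (hF : IsClosed F)
    (hT : ∀ t ∈ F, toralMap (companionMatrix r σ) t ∈ F) (hi : (interior F).Nonempty) :
    F = Set.univ := by
  obtain ⟨t, ht⟩ := hi
  obtain ⟨⟨x, y⟩, rfl⟩ := h.leaf_surjective t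
  have hl := h.pos
  have hev : ∀ᶠ u in 𝓝 (0 : ℝ), leaf l c (x + u, y) ∈ F := by
    have hc : Continuous fun u : ℝ => leaf l c (x + u, y) :=
      (continuous_leaf l c).comp (by fun_prop)
    refine hc.continuousAt.eventually_mem ?_
    simpa using mem_interior_iff_mem_nhds.1 ht
  have hTn (k : ℕ) {t} (ht : t ∈ F) : (toralMap (companionMatrix r σ))^[k] t ∈ F := by
    induction k with
    | zero => exact ht
    | succ k ih => rw [Function.iterate_succ_apply']; exact hT _ ih
  obtain ⟨p, φ, hφ, hp⟩ := CompactSpace.tendsto_subseq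
    fun k : ℕ => (toralMap (companionMatrix r σ))^[k] (leaf l c (x, y))
  -- An expanding segment around the interior point is stretched by l^k under the k-th iterate. At
  -- an accumulation point `p` of the orbit, closedness therefore gives the whole expanding leaf,
  -- which is dense.
  have hline (u : ℝ) : p + leaf l c (u, 0) ∈ F := by
    have h0 : Tendsto (fun k => u * (l⁻¹) ^ (φ k)) atTop (𝓝 0) := by
      have := (tendsto_pow_atTop_nhds_zero_of_lt_one (inv_nonneg.2 hl.le)
        (inv_lt_one_of_one_lt₀ h.one_lt)).comp hφ.tendsto_atTop
      simpa using this.const_mul u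
    refine hF.mem_of_tendsto (hp.add_const (leaf l c (u, 0))) ?_
    filter_upwards [h0.eventually hev] with k hk
    convert hTn (φ k) hk using 1
    simp only [Function.comp, h.iterate_toralMap_companion, ← map_add]
    congr 1
    ext
    · simp only [inv_pow, Prod.mk_add_mk]; field_simp
    · simp
  refine Set.eq_univ_of_forall fun t => ?_
  have hmem : t - p ∈ closure {t | ∃ x : ℝ, 0 ≤ x ∧ t = leaf l c (x, 0)} := by
    rw [h.closure_halfLeaf]; trivial
  have := map_mem_closure (continuous_const_add p) hmem (t := F) (by
    rintro _ ⟨u, _, rfl⟩; exact hline u)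
  rw [hF.closure_eq] at this
  simpa using this

end QuadUnit

/-! ### Digit sequences, their future and past sums, and the coding map -/

theorem reflect_mem {l : ℝ} {ε : ℤ → ℕ} (hε : ε ∈ PrimarySet l) :
    (fun n => ε (-n)) ∈ PrimarySet l :=
  ⟨hε.2, by simpa using hε.1⟩

theorem unshift_mem {l : ℝ} {ε : ℤ → ℕ} (hε : ε ∈ PrimarySet l) :
    (fun n => ε (n - 1)) ∈ PrimarySet l := by
  have := reflect_mem (shift_mem ⟨_, reflect_mem hε⟩)
  refine (congrArg (· ∈ PrimarySet l) (funext fun n => ?_)).mp this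
  simp only; congr 1; ring

theorem translate_mem {l : ℝ} {ε : ℤ → ℕ} (hε : ε ∈ PrimarySet l) (n : ℤ) :
    (fun k => ε (k + n)) ∈ PrimarySet l := by
  induction n with
  | zero => simpa using hε
  | succ n ih =>
    refine (congrArg (· ∈ PrimarySet l) (funext fun k => ?_)).mp (shift_mem ⟨_, ih⟩)
    simp only; congr 1; ring
  | pred n ih =>
    refine (congrArg (· ∈ PrimarySet l) (funext fun k => ?_)).mp (unshift_mem ih)
    congr 1; ring

theorem mem_of_finite_support {l : ℝ} {ε : ℤ → ℕ} (hε : (Function.support ε).Finite) :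
    ε ∈ PrimarySet l := by
  have key (f : ℕ → ℤ) (hf : Function.Injective f) :
      Summable fun n : ℕ => (ε (f n) : ℝ) / l ^ (n + 1) := by
    refine summable_of_hasFiniteSupport ((hε.preimage hf.injOn).subset fun n hn => ?_)
    simp only [Function.mem_support, Set.mem_preimage] at hn ⊢
    intro h0; simp [h0] at hn
  exact ⟨key (fun n => (n : ℤ) + 1) fun a b hab => by simpa using hab,
    key (fun n => -((n : ℤ) + 1)) fun a b hab => by simpa using hab⟩

theorem mem_of_bounded {l : ℝ} (hl : 1 < l) {ε : ℤ → ℕ} {b : ℕ} (hε : ∀ n, ε n ≤ b) :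
    ε ∈ PrimarySet l := by
  have hl0 : 0 < l := by linarith
  have key (f : ℕ → ℤ) : Summable fun n : ℕ => (ε (f n) : ℝ) / l ^ (n + 1) := by
    have hs : Summable fun n : ℕ => (b : ℝ) * (l⁻¹) ^ (n + 1) :=
      ((summable_nat_add_iff 1).2 (summable_geometric_of_lt_one (inv_nonneg.2 hl0.le)
        (inv_lt_one_of_one_lt₀ hl))).mul_left _
    refine hs.of_nonneg_of_le (fun n => by positivity) fun n => ?_
    rw [inv_pow, ← div_eq_mul_inv]
    have : (ε (f n) : ℝ) ≤ b := by exact_mod_cast hε _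
    gcongr
  exact ⟨key _, key _⟩

/-- The sum `∑_{k ≥ 1} ε_{n+k} l^{-k}`. -/
noncomputable def fut (l : ℝ) (ε : ℤ → ℕ) (n : ℤ) : ℝ :=
  ∑' k : ℕ, (ε (n + (k + 1)) : ℝ) / l ^ (k + 1)

/-- The sum `∑_{k ≥ 0} ε_{n-k} c^k`. -/
noncomputable def past (c : ℝ) (ε : ℤ → ℕ) (n : ℤ) : ℝ :=
  ∑' k : ℕ, (ε (n - k) : ℝ) * c ^ k

theorem summable_fut {l : ℝ} {ε : ℤ → ℕ} (hε : ε ∈ PrimarySet l) (n : ℤ) :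
    Summable fun k : ℕ => (ε (n + (k + 1)) : ℝ) / l ^ (k + 1) := by
  refine (translate_mem hε n).1.congr fun k => ?_
  rw [add_comm n]

theorem fut_shift {l : ℝ} (ε : PrimarySet l) (n : ℤ) :
    fut l (shift ε).1 n = fut l ε.1 (n + 1) := by
  refine tsum_congr fun k => ?_
  simp only [shift]
  rw [show n + ((k : ℤ) + 1) + 1 = n + 1 + (k + 1) by ring]

theorem past_shift {l : ℝ} (c : ℝ) (ε : PrimarySet l) (n : ℤ) :
    past c (shift ε).1 n = past c ε.1 (n + 1) := by
  refine tsum_congr fun k => ?_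
  simp only [shift]
  rw [show n - (k : ℤ) + 1 = n + 1 - k by ring]

theorem fut_rec {l : ℝ} (hl : l ≠ 0) {ε : ℤ → ℕ} (hε : ε ∈ PrimarySet l) (n : ℤ) :
    l * fut l ε n = ε (n + 1) + fut l ε (n + 1) := by
  unfold fut
  rw [(summable_fut hε n).tsum_eq_zero_add, mul_add, ← tsum_mul_left]
  congr 1
  · simp; field_simp
  · refine tsum_congr fun k => ?_
    rw [pow_succ l (k + 1)]
    push_cast
    rw [show n + ((k : ℤ) + 1 + 1) = n + 1 + (k + 1) by ring]
    field_simp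

theorem fut_nonneg {l : ℝ} (hl : 0 < l) (ε : ℤ → ℕ) (n : ℤ) : 0 ≤ fut l ε n :=
  tsum_nonneg fun _ => by positivity

theorem fut_add {l : ℝ} {ε ε' : ℤ → ℕ} (hε : ε ∈ PrimarySet l) (hε' : ε' ∈ PrimarySet l) (n : ℤ) :
    fut l (ε + ε') n = fut l ε n + fut l ε' n := by
  unfold fut
  rw [← (summable_fut hε n).tsum_add (summable_fut hε' n)]
  refine tsum_congr fun k => ?_
  simp [add_div]

/-- The coding map `L_ξ` for `ξ = (m + n l) / (l - c)`. -/
noncomputable def coding (l c : ℝ) (m n : ℤ) (ε : PrimarySet l) : Torus2 :=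
  leaf l c ((m + n * l) * fut l ε.1 0, -((m + n * c) * past c ε.1 0))

theorem continuous_digit {l : ℝ} (n : ℤ) : Continuous fun ε : PrimarySet l => (ε.1 n : ℝ) :=
  continuous_of_discreteTopology.comp ((continuous_apply n).comp continuous_subtype_val)

namespace QuadUnit

variable {r : ℕ} {σ : ℤ} {l c : ℝ} (h : QuadUnit r σ l c)
include h

theorem summable_past {ε : ℤ → ℕ} (hε : ε ∈ PrimarySet l) (n : ℤ) :
    Summable fun k : ℕ => (ε (n - k) : ℝ) * c ^ k := by
  refine (summable_nat_add_iff 1).1 (((translate_mem hε n).2).of_norm_bounded fun k => ?_)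
  rw [norm_mul, norm_pow, Real.norm_eq_abs, Real.norm_eq_abs, h.abs_conj, Nat.abs_cast,
    one_div_pow, mul_one_div]
  refine le_of_eq ?_
  congr 3
  push_cast; ring

theorem past_rec {ε : ℤ → ℕ} (hε : ε ∈ PrimarySet l) (n : ℤ) :
    past c ε (n + 1) = ε (n + 1) + c * past c ε n := by
  unfold past
  rw [(h.summable_past hε (n + 1)).tsum_eq_zero_add, ← tsum_mul_left]
  congr 1
  · simp
  · refine tsum_congr fun k => ?_
    rw [show n + 1 - ((k + 1 : ℕ) : ℤ) = n - k by push_cast; ring]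
    ring

theorem past_add {ε ε' : ℤ → ℕ} (hε : ε ∈ PrimarySet l) (hε' : ε' ∈ PrimarySet l) (n : ℤ) :
    past c (ε + ε') n = past c ε n + past c ε' n := by
  unfold past
  rw [← (h.summable_past hε n).tsum_add (h.summable_past hε' n)]
  refine tsum_congr fun k => ?_
  simp [add_mul]

theorem coding_add (m n : ℤ) (ε ε' : PrimarySet l) :
    coding l c m n (ε + ε') = coding l c m n ε + coding l c m n ε' := by
  unfold coding
  rw [← map_add, AddSubmonoid.coe_add, fut_add ε.2 ε'.2, h.past_add ε.2 ε'.2]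
  congr 1; ext <;> simp <;> ring

/-- The shift moves the digit at place 1 from the future to the past; the discrepancy is minus that
digit times the lattice vector of m + nl. -/
theorem coding_shift (m n : ℤ) (ε : PrimarySet l) :
    coding l c m n (shift ε) = toralMap (companionMatrix r σ) (coding l c m n ε) := by
  unfold coding
  rw [h.toralMap_companion, fut_shift, past_shift, h.leaf_eq_iff, h.past_rec ε.2 0]
  refine ⟨-ε.1 (0 + 1) * m, -ε.1 (0 + 1) * n, ?_⟩
  have := fut_rec h.pos.ne' ε.2 0
  simp only [zero_add] at this ⊢
  ext
  · push_cast; simp only [Prod.mk_add_mk]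
    linear_combination (-(m + n * l)) * this
  · push_cast; simp only [Prod.mk_add_mk]; ring

theorem coding_eq_toralMap (m n : ℤ) (ε : PrimarySet l) :
    coding l c m n ε = toralMap (mulMatrix r σ m n) (coding l c 1 0 ε) := by
  unfold coding
  rw [h.toralMap_mulMatrix]
  simp

theorem continuousOn_coding (m n : ℤ) (w : PrimarySet l) :
    ContinuousOn (coding l c m n) {ε | ∀ n, ε.1 n ≤ w.1 n} := by
  have h1 : ContinuousOn (fun ε : PrimarySet l => fut l ε.1 0) {ε | ∀ n, ε.1 n ≤ w.1 n} := by
    refine continuousOn_tsum (fun k => ((continuous_digit _).div_const _).continuousOn)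
      (summable_fut w.2 0) fun k ε hε => ?_
    have := h.pos
    rw [Real.norm_of_nonneg (by positivity)]
    gcongr
    exact hε _
  have h2 : ContinuousOn (fun ε : PrimarySet l => past c ε.1 0) {ε | ∀ n, ε.1 n ≤ w.1 n} := by
    refine continuousOn_tsum (fun k => ((continuous_digit _).mul_const _).continuousOn)
      (h.summable_past w.2 0).norm fun k ε hε => ?_
    simp only [norm_mul, Real.norm_natCast]
    gcongr
    exact hε _
  exact (continuous_leaf l c).comp_continuousOn
    ((h1.const_mul _).prodMk ((h2.const_mul _).neg))

/-- This vanishing is what allows digits at places ≤ 0 to pass from the expanding to the contracting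
coordinate with a change of sign. -/
theorem leaf_zpow (m n k : ℤ) :
    leaf l c ((m + n * l) * l ^ k, (m + n * c) * c ^ k) = 0 := by
  obtain ⟨a, b, ha, hb⟩ := h.zpow_mem k
  have h0 : leaf l c (l ^ k, c ^ k) = 0 := (h.leaf_eq_zero_iff _).2 ⟨a, b, by rw [ha, hb]⟩
  have := h.toralMap_mulMatrix m n (l ^ k, c ^ k)
  rw [h0] at this
  rw [← this]
  exact (toralHom _).map_zero

/-- The growing terms with l^k, k ≥ 0, are replaced modulo the lattice by terms with c^k, which tend
to 0 fast enough to be summed. This is why the limit defining L_ξ exists although the real sum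
diverges in general. -/
theorem leaf_partialSum (m n : ℤ) (ε : ℤ → ℕ) (N : ℕ) :
    leaf l c ((m + n * l) * ∑ k ∈ Finset.Icc (-(N : ℤ)) N, (ε k : ℝ) * l ^ (-k), 0) =
      leaf l c ((m + n * l) * ∑ k ∈ Finset.range N, (ε (0 + (k + 1)) : ℝ) / l ^ (k + 1),
        -((m + n * c) * ∑ k ∈ Finset.range (N + 1), (ε (0 - k) : ℝ) * c ^ k)) := by
  have hz (k : ℤ) (a : ℕ) : leaf l c ((m + n * l) * ((a : ℝ) * l ^ k), 0) =
      leaf l c (0, -((m + n * c) * (a * c ^ k))) := by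
    rw [← sub_eq_zero, ← map_sub]
    have := congrArg (a • ·) (h.leaf_zpow m n k)
    simp only [← map_nsmul, smul_zero] at this
    rw [← this]
    congr 1; ext <;> simp <;> ring
  have hp (x : ℝ) (N : ℕ) : x ^ ((N : ℤ) + 1) = x ^ (N + 1) := by
    exact_mod_cast zpow_natCast x (N + 1)
  induction N with
  | zero =>
    have := hz 0 (ε 0)
    simpa using this
  | succ N ih =>
    have hset : Finset.Icc (-((N + 1 : ℕ) : ℤ)) (N + 1 : ℕ) =
        insert ((N : ℤ) + 1) (insert (-((N : ℤ) + 1)) (Finset.Icc (-(N : ℤ)) N)) := by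
      ext k; simp only [Finset.mem_Icc, Finset.mem_insert]; push_cast; omega
    have e1 : ((m + n * l) * ∑ k ∈ Finset.Icc (-((N + 1 : ℕ) : ℤ)) (N + 1 : ℕ),
        (ε k : ℝ) * l ^ (-k), (0 : ℝ)) =
        ((m + n * l) * ((ε (N + 1) : ℝ) / l ^ (N + 1)), 0) +
        (((m + n * l) * ((ε (-(N + 1)) : ℝ) * l ^ ((N : ℤ) + 1)), 0) +
        ((m + n * l) * ∑ k ∈ Finset.Icc (-(N : ℤ)) N, (ε k : ℝ) * l ^ (-k), 0)) := by
      rw [hset, Finset.sum_insert (by simp; omega), Finset.sum_insert (by simp)]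
      ext
      · simp only [Prod.mk_add_mk, zpow_neg, neg_neg, hp l]
        ring
      · simp
    rw [e1, map_add, map_add, ih, hz, ← map_add, ← map_add]
    conv_rhs => rw [Finset.sum_range_succ, Finset.sum_range_succ]
    congr 1
    ext
    · simp; ring
    · simp [hp c]; ring

theorem tendsto_coding (m n : ℤ) (ε : PrimarySet l) :
    Tendsto (fun N : ℕ => leaf l c
      ((m + n * l) * ∑ k ∈ Finset.Icc (-(N : ℤ)) N, (ε.1 k : ℝ) * l ^ (-k), 0)) atTop
      (𝓝 (coding l c m n ε)) := by
  simp only [h.leaf_partialSum]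
  refine ((continuous_leaf l c).tendsto _).comp ?_
  refine Tendsto.prodMk_nhds ?_ ?_
  · exact (summable_fut ε.2 0).hasSum.tendsto_sum_nat.const_mul _
  · exact (((h.summable_past ε.2 0).hasSum.tendsto_sum_nat.comp
      (tendsto_add_atTop_nat 1)).const_mul _).neg

theorem toralMap_companion_injective :
    Function.Injective (toralMap (companionMatrix r σ)) := by
  refine (injective_iff_map_eq_zero (toralHom (companionMatrix r σ))).2 fun t ht => ?_
  obtain ⟨⟨x, y⟩, rfl⟩ := h.leaf_surjective t
  replace ht : toralMap (companionMatrix r σ) (leaf l c (x, y)) = 0 := ht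
  rw [h.toralMap_companion, h.leaf_eq_zero_iff] at ht
  obtain ⟨m, n, hmn⟩ := ht
  have h1 : l * x = m + n * l := congrArg Prod.fst hmn
  have h2 : c * y = m + n * c := congrArg Prod.snd hmn
  have hσ := h.sigma_sq
  have hm := h.mul_eq
  have e1 : σ * c * l = 1 := by rw [← hσ, ← hm]; ring
  rw [h.leaf_eq_zero_iff]
  refine ⟨n + σ * m * r, -σ * m, ?_⟩
  ext
  · push_cast
    rw [← h.add_eq]
    linear_combination (σ * c) * h1 + (n - x) * e1
  · push_cast
    rw [← h.add_eq]
    linear_combination (σ * l) * h2 + (n - y) * e1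

end QuadUnit

/-! ### The symbolic compactum is closed, shift-invariant and total -/

theorem isClosed_digits {l : ℝ} (s : ℤ) (P : ℕ → Prop) : IsClosed {ε : PrimarySet l | P (ε.1 s)} :=
  (isClosed_discrete {a | P a}).preimage ((continuous_apply s).comp continuous_subtype_val)

theorem isOpen_digits {l : ℝ} (s : ℤ) (P : ℕ → Prop) : IsOpen {ε : PrimarySet l | P (ε.1 s)} :=
  (isOpen_discrete {a | P a}).preimage ((continuous_apply s).comp continuous_subtype_val)

theorem isClosed_symbolicCompactum (l : ℝ) (r : ℕ) (σ : ℤ) :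
    IsClosed (symbolicCompactum l r σ) := by
  have h1 : IsClosed {ε : PrimarySet l | ∀ n : ℤ, ε.1 n ≤ r ∧ (ε.1 n = r → ε.1 (n + 1) = 0)} := by
    have : {ε : PrimarySet l | ∀ n : ℤ, ε.1 n ≤ r ∧ (ε.1 n = r → ε.1 (n + 1) = 0)} =
        ⋂ n : ℤ, {ε | ε.1 n ≤ r} ∩ ({ε | ε.1 n ≠ r} ∪ {ε | ε.1 (n + 1) = 0}) := by
      ext ε; simp [imp_iff_not_or]
    rw [this]
    exact isClosed_iInter fun n => (isClosed_digits n (· ≤ r)).inter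
      ((isClosed_digits n (· ≠ r)).union (isClosed_digits (n + 1) (· = 0)))
  have h2 : IsClosed {ε : PrimarySet l | (∀ n : ℤ, ε.1 n + 1 ≤ r) ∧
      ∀ (n : ℤ) (j : ℕ), ¬ (ε.1 n + 1 = r ∧ (∀ i : ℕ, 1 ≤ i → i ≤ j → ε.1 (n + (i : ℤ)) + 2 = r) ∧
        ε.1 (n + (j : ℤ) + 1) + 1 = r)} := by
    have : {ε : PrimarySet l | (∀ n : ℤ, ε.1 n + 1 ≤ r) ∧
      ∀ (n : ℤ) (j : ℕ), ¬ (ε.1 n + 1 = r ∧ (∀ i : ℕ, 1 ≤ i → i ≤ j → ε.1 (n + (i : ℤ)) + 2 = r) ∧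
        ε.1 (n + (j : ℤ) + 1) + 1 = r)} = (⋂ n : ℤ, {ε | ε.1 n + 1 ≤ r}) ∩
        ⋂ (n : ℤ) (j : ℕ), ({ε | ε.1 n + 1 = r} ∩
          ((⋂ i ∈ Finset.Icc 1 j, {ε | ε.1 (n + (i : ℤ)) + 2 = r}) ∩
            {ε | ε.1 (n + (j : ℤ) + 1) + 1 = r}))ᶜ := by
      ext ε; simp
    rw [this]
    exact (isClosed_iInter fun n => isClosed_digits n (· + 1 ≤ r)).inter
      (isClosed_iInter fun n => isClosed_iInter fun j => ((isOpen_digits n (· + 1 = r)).inter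
        ((isOpen_biInter_finset fun (i : ℕ) _ => isOpen_digits (n + (i : ℤ)) (· + 2 = r)).inter
          (isOpen_digits (n + j + 1) (· + 1 = r)))).isClosed_compl)
  by_cases hn : σ = -1 <;> by_cases hp : σ = 1
  · omega
  · convert h1 using 2; simp [symbolicCompactum, hn]
  · convert h2 using 2; simp [symbolicCompactum, hp]
  · convert isClosed_univ using 1
    ext ε; simp [symbolicCompactum, hn, hp]

theorem shift_mem_symbolicCompactum {l : ℝ} {r : ℕ} {σ : ℤ} (ε : PrimarySet l) :
    shift ε ∈ symbolicCompactum l r σ ↔ ε ∈ symbolicCompactum l r σ := by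
  constructor
  · rintro ⟨h1, h2⟩
    refine ⟨fun hs n => ?_, fun hs => ⟨fun n => ?_, fun n j => ?_⟩⟩
    · simpa [shift] using h1 hs (n - 1)
    · simpa [shift] using (h2 hs).1 (n - 1)
    · rintro ⟨a1, a2, a3⟩
      refine (h2 hs).2 (n - 1) j ⟨by simpa [shift] using a1, fun i hi hj => ?_, ?_⟩
      · rw [← a2 i hi hj]; simp only [shift]; ring_nf
      · rw [← a3]; simp only [shift]; ring_nf
  · rintro ⟨h1, h2⟩
    refine ⟨fun hs n => h1 hs (n + 1), fun hs => ⟨fun n => (h2 hs).1 (n + 1), fun n j => ?_⟩⟩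
    rintro ⟨a1, a2, a3⟩
    refine (h2 hs).2 (n + 1) j ⟨a1, fun i hi hj => ?_, ?_⟩
    · rw [← a2 i hi hj]; simp only [shift]; ring_nf
    · rw [← a3]; simp only [shift]; ring_nf

/-- A forbidden block of the smaller sequence ε' is copied by ε at `N` up to the first difference,
where ε has the larger digit. Within its digit bounds ε would then contain that block or a shorter
forbidden one. -/
theorem isTotalSet_symbolicCompactum (l : ℝ) (r : ℕ) (σ : ℤ) :
    IsTotalSet (symbolicCompactum l r σ) := by
  rintro ε ⟨h1, h2⟩ ε' ⟨N, hN⟩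
  have hfirst (k : ℤ) : ε'.1 k ≤ ε.1 N := by
    obtain ⟨n, hn, hm⟩ := hN k
    rcases Nat.eq_zero_or_pos n with rfl | h0
    · simpa using hn.le
    · simpa using (hm 0 h0).le
  refine ⟨fun hs n => ?_, fun hs => ⟨fun n => ?_, fun n j => ?_⟩⟩
  · obtain ⟨a1, a2⟩ := h1 hs N
    refine ⟨(hfirst n).trans a1, fun hr => ?_⟩
    have hNr : ε.1 N = r := le_antisymm a1 (hr ▸ hfirst n)
    obtain ⟨m, hm, hm'⟩ := hN n
    have h0 := a2 hNr
    rcases Nat.lt_or_ge 1 m with h1m | h1m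
    · have := hm' 1 h1m
      simp only [Nat.cast_one] at this
      rw [this, h0]
    · interval_cases m
      · simp [hr, hNr] at hm
      · simp [h0] at hm
  · exact (Nat.add_le_add_right (hfirst n) 1).trans ((h2 hs).1 N)
  · rintro ⟨b1, b2, b3⟩
    obtain ⟨c1, c2⟩ := h2 hs
    have hNr : ε.1 N + 1 = r := le_antisymm (c1 N) (by have := hfirst n; omega)
    obtain ⟨m, hm, hm'⟩ := hN n
    simp only at hm hm'
    have hmid (i : ℕ) (hi : 1 ≤ i) (hij : i ≤ j) (him : i < m) : ε.1 (N + i) + 2 = r := by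
      rw [← hm' i him]; exact b2 i hi hij
    have hm0 : 1 ≤ m := by
      rcases Nat.eq_zero_or_pos m with rfl | h0
      · simp at hm; omega
      · exact h0
    rcases Nat.lt_or_ge (j + 1) m with hj | hj
    · refine c2 N j ⟨hNr, fun i hi hij => hmid i hi hij (by omega), ?_⟩
      have := hm' (j + 1) hj
      push_cast at this
      rw [add_assoc, ← this, ← add_assoc]; exact b3
    · have hcm := c1 (N + m)
      rcases Nat.lt_or_ge j m with hj' | hj'
      · obtain rfl : m = j + 1 := by omega
        push_cast at hm hcm
        rw [← add_assoc] at hm hcm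
        rw [← add_assoc] at hm
        have : ε'.1 (n + j + 1) + 1 = r := b3
        omega
      · have hb := b2 m hm0 hj'
        refine c2 N (m - 1) ⟨hNr, fun i hi hij => hmid i hi (by omega) (by omega), ?_⟩
        have e : N + ((m - 1 : ℕ) : ℤ) + 1 = N + m := by omega
        rw [e]; omega

/-- The constant sequence `r`. -/
def constSeq {l : ℝ} (hl : 1 < l) (r : ℕ) : PrimarySet l :=
  ⟨fun _ => r, mem_of_bounded hl fun _ => le_rfl⟩

theorem isCompact_le_const {l : ℝ} (hl : 1 < l) (r : ℕ) :
    IsCompact {ε : PrimarySet l | ∀ n, ε.1 n ≤ r} := by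
  rw [Topology.IsInducing.subtypeVal.isCompact_iff]
  have : (Subtype.val '' {ε : PrimarySet l | ∀ n, ε.1 n ≤ r} : Set (ℤ → ℕ)) =
      Set.univ.pi fun _ => Set.Iic r := by
    ext ε
    simp only [Set.mem_image, Set.mem_ofPred_eq, Set.mem_univ_pi, Set.mem_Iic]
    constructor
    · rintro ⟨ε, hε, rfl⟩; exact hε
    · exact fun hε => ⟨⟨ε, mem_of_bounded hl hε⟩, hε, rfl⟩
  have h2 : IsCompact (Set.univ.pi fun _ : ℤ => Set.Iic r) :=
    isCompact_univ_pi fun _ => (Set.finite_Iic r).isCompact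
  rw [← this] at h2
  exact h2

/-! ### The two-state automaton and the bounds on future and past -/

/-- A labelling of the positions of `ε` by the state of the automaton that recognizes the symbolic
compactum: `q n` says that the digit at `n + 1` is subject to the stronger bound. -/
structure IsLabelling (r : ℕ) (σ : ℤ) (ε : ℤ → ℕ) (q : ℤ → Prop) : Prop where
  neg : σ = -1 → ∀ n, ε n ≤ r ∧ (q n ↔ ε n = r) ∧ (q n → ε (n + 1) = 0)
  pos_free : σ = 1 → ∀ n, ¬ q n → ε (n + 1) + 1 ≤ r ∧ (q (n + 1) ↔ ε (n + 1) + 1 = r)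
  pos_bound : σ = 1 → ∀ n, q n → ε (n + 1) + 2 ≤ r ∧ (q (n + 1) ↔ ε (n + 1) + 2 = r)

theorem exists_labelling {l : ℝ} {r : ℕ} {σ : ℤ} (hσ : σ = -1 ∨ σ = 1) {ε : PrimarySet l}
    (hε : ε ∈ symbolicCompactum l r σ) : ∃ q, IsLabelling r σ ε.1 q := by
  rcases hσ with rfl | rfl
  · refine ⟨fun n => ε.1 n = r, fun _ n => ?_, fun h => by simp at h, fun h => by simp at h⟩
    have := hε.1 rfl n
    exact ⟨this.1, Iff.rfl, this.2⟩
  · obtain ⟨h1, h2⟩ := hε.2 rfl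
    have hprev {n : ℤ} {j : ℕ} (hj : ∀ i : ℕ, i < j + 1 → ε.1 (n + 1 - i) + 2 = r) (i : ℕ)
        (hi : i < j) : ε.1 (n - i) + 2 = r := by
      rw [← hj (i + 1) (by omega)]; push_cast; ring_nf
    -- The state at n is on when a leftward run of digits r − 2 from n, possibly empty, ends at a
    -- digit r − 1: one more r − 1 would complete a forbidden block.
    refine ⟨fun n => ∃ j : ℕ, ε.1 (n - j) + 1 = r ∧ ∀ i : ℕ, i < j → ε.1 (n - i) + 2 = r,
      fun h => by simp at h, fun _ n hq => ⟨h1 _, ?_, ?_⟩, fun _ n hq => ?_⟩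
    · rintro ⟨j, hj1, hj2⟩
      cases j with
      | zero => simpa using hj1
      | succ j =>
        refine absurd ⟨j, ?_, hprev hj2⟩ hq
        rw [← hj1]; push_cast; ring_nf
    · exact fun h0 => ⟨0, by simpa using h0, fun i hi => absurd hi (Nat.not_lt_zero i)⟩
    · obtain ⟨j, hj1, hj2⟩ := hq
      have hne : ε.1 (n + 1) + 1 ≠ r := by
        intro h0
        refine h2 (n - j) j ⟨hj1, fun i hi hij => ?_, ?_⟩
        · rw [← hj2 (j - i) (by omega)]; rw [Nat.cast_sub hij]; ring_nf
        · rw [← h0]; ring_nf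
      have := h1 (n + 1)
      refine ⟨by omega, ?_, fun h0 => ⟨j + 1, ?_, fun i hi => ?_⟩⟩
      · rintro ⟨j', hj1', hj2'⟩
        cases j' with
        | zero => exact absurd (by simpa using hj1') hne
        | succ j' => simpa using hj2' 0 (by omega)
      · rw [← hj1]; push_cast; ring_nf
      · cases i with
        | zero => simpa using h0
        | succ i => rw [← hj2 i (by omega)]; push_cast; ring_nf

/-- A sequence that is bounded above and contracts backwards is nonpositive. -/
theorem nonpos_of_contraction {e : ℕ → ℝ} {q M : ℝ} (hq0 : 0 ≤ q) (hq1 : q < 1)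
    (hM : ∀ k, e k ≤ M) (he : ∀ k, e k ≤ q * e (k + 1)) : e 0 ≤ 0 := by
  have h1 (k : ℕ) : e 0 ≤ q ^ k * e k := by
    induction k with
    | zero => simp
    | succ k ih =>
      calc e 0 ≤ q ^ k * e k := ih
        _ ≤ q ^ k * (q * e (k + 1)) := by gcongr; exact he k
        _ = _ := by ring
  have h2 : Tendsto (fun k : ℕ => q ^ k * M) atTop (𝓝 0) := by
    simpa using (tendsto_pow_atTop_nhds_zero_of_lt_one hq0 hq1).mul_const M
  exact ge_of_tendsto' h2 fun k => (h1 k).trans (by gcongr; exact hM k)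

theorem fut_le_of_bounded {l : ℝ} (hl : 1 < l) {ε : ℤ → ℕ} {b : ℕ} (hε : ∀ n, ε n ≤ b) (n : ℤ) :
    fut l ε n ≤ fut l (fun _ => b) 0 := by
  refine (summable_fut (mem_of_bounded hl hε) n).tsum_le_tsum (fun k => ?_)
    (summable_fut (mem_of_bounded hl fun _ => le_rfl) 0)
  gcongr
  exact hε _

section Bounds
open scoped Classical in
/-- The bound on `fut` in each state. -/
noncomputable def futBound (σ : ℤ) (c : ℝ) (q : Prop) : ℝ := if q then (1 + σ) / 2 - c else 1

open scoped Classical in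
/-- The lower bound on `past` in each state. -/
noncomputable def pastLower (σ : ℤ) (l : ℝ) (q : Prop) : ℝ := if q then l - 1 else (σ - 1) / 2

open scoped Classical in
/-- The upper bound on `past` in each state. -/
noncomputable def pastUpper (l : ℝ) (q : Prop) : ℝ := if q then l else l - 1
end Bounds

/-- The elements of `ℤ[l]`. -/
def quadInts (l : ℝ) : Set ℝ := Set.range fun p : ℤ × ℤ => (p.1 : ℝ) + p.2 * l

theorem countable_quadInts (l : ℝ) : (quadInts l).Countable := Set.countable_range _

theorem mem_quadInts (l : ℝ) (m n : ℤ) : (m : ℝ) + n * l ∈ quadInts l := ⟨(m, n), rfl⟩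

namespace QuadUnit

variable {r : ℕ} {σ : ℤ} {l c : ℝ} (h : QuadUnit r σ l c)
include h

theorem sigma_cases : σ = -1 ∨ σ = 1 := h.cases.imp And.left And.left

theorem digit_le {ε : PrimarySet l} (hε : ε ∈ symbolicCompactum l r σ) (n : ℤ) : ε.1 n ≤ r := by
  rcases h.sigma_cases with hσ | hσ
  · exact (hε.1 hσ n).1
  · have := (hε.2 hσ).1 n; omega

/-- The ranges of the real digit steps, in the two cases of the automaton. -/
theorem step_cases {ε : ℤ → ℕ} {q : ℤ → Prop} (hq : IsLabelling r σ ε q) (n : ℤ) :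
    (σ = -1 ∧ 1 ≤ (r : ℝ) ∧ ((¬ q n ∧ ¬ q (n + 1) ∧ (ε (n + 1) : ℝ) + 1 ≤ r) ∨
      (¬ q n ∧ q (n + 1) ∧ (ε (n + 1) : ℝ) = r) ∨ (q n ∧ ¬ q (n + 1) ∧ (ε (n + 1) : ℝ) = 0))) ∨
    (σ = 1 ∧ 3 ≤ (r : ℝ) ∧ ((¬ q n ∧ ¬ q (n + 1) ∧ (ε (n + 1) : ℝ) + 2 ≤ r) ∨
      (¬ q n ∧ q (n + 1) ∧ (ε (n + 1) : ℝ) + 1 = r) ∨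
      (q n ∧ ¬ q (n + 1) ∧ (ε (n + 1) : ℝ) + 3 ≤ r) ∨
      (q n ∧ q (n + 1) ∧ (ε (n + 1) : ℝ) + 2 = r))) := by
  norm_cast
  rcases h.cases with ⟨hσ, hr⟩ | ⟨hσ, hr⟩
  · left
    refine ⟨hσ, hr, ?_⟩
    obtain ⟨_, _, a3⟩ := hq.neg hσ n
    obtain ⟨b1, b2, _⟩ := hq.neg hσ (n + 1)
    by_cases h1 : q n
    · have := a3 h1
      exact Or.inr (Or.inr ⟨h1, fun h2 => by have := b2.1 h2; omega, this⟩)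
    · by_cases h2 : q (n + 1)
      · exact Or.inr (Or.inl ⟨h1, h2, b2.1 h2⟩)
      · have := mt b2.2 h2
        exact Or.inl ⟨h1, h2, by omega⟩
  · right
    refine ⟨hσ, hr, ?_⟩
    by_cases h1 : q n
    · obtain ⟨b1, b2⟩ := hq.pos_bound hσ n h1
      by_cases h2 : q (n + 1)
      · exact Or.inr (Or.inr (Or.inr ⟨h1, h2, b2.1 h2⟩))
      · have := mt b2.2 h2
        exact Or.inr (Or.inr (Or.inl ⟨h1, h2, by omega⟩))
    · obtain ⟨b1, b2⟩ := hq.pos_free hσ n h1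
      by_cases h2 : q (n + 1)
      · exact Or.inr (Or.inl ⟨h1, h2, b2.1 h2⟩)
      · have := mt b2.2 h2
        exact Or.inl ⟨h1, h2, by omega⟩

/-- The constants in `futBound` solve the recursion of `fut` along the automaton, with equality when
the digit is the largest one allowed in the current state. -/
theorem futBound_step {ε : ℤ → ℕ} {q : ℤ → Prop} (hq : IsLabelling r σ ε q) (n : ℤ) :
    ε (n + 1) + futBound σ c (q (n + 1)) ≤ l * futBound σ c (q n) := by
  have h1 := h.one_lt
  have h2 := h.add_eq
  have h3 := h.mul_eq
  rcases h.step_cases hq n with ⟨hσ, hr, H⟩ | ⟨hσ, hr, H⟩ <;> subst hσ <;> push_cast at h3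
  · rcases H with ⟨a, b, e⟩ | ⟨a, b, e⟩ | ⟨a, b, e⟩ <;>
      simp only [futBound, a, b, if_true, if_false] <;> push_cast <;> nlinarith
  · rcases H with ⟨a, b, e⟩ | ⟨a, b, e⟩ | ⟨a, b, e⟩ | ⟨a, b, e⟩ <;>
      simp only [futBound, a, b, if_true, if_false] <;> push_cast <;> nlinarith

theorem futBound_pos (q : Prop) : 0 < futBound σ c q := by
  have := abs_lt.1 h.abs_conj_lt_one
  have h3 := h.mul_eq
  have := h.pos
  rcases h.sigma_cases with rfl | rfl <;> unfold futBound <;> split_ifs <;> push_cast at * <;>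
    nlinarith

theorem futBound_le_one (q : Prop) : futBound σ c q ≤ 1 := by
  have := abs_lt.1 h.abs_conj_lt_one
  have h3 := h.mul_eq
  have := h.pos
  rcases h.sigma_cases with rfl | rfl <;> unfold futBound <;> split_ifs <;> push_cast at * <;>
    nlinarith

/-- The excess over the bound is multiplied by at most 1/l when moving one place to the left and is
bounded above, so it is nonpositive. -/
theorem fut_le_futBound {ε : PrimarySet l} (hε : ε ∈ symbolicCompactum l r σ) {q : ℤ → Prop}
    (hq : IsLabelling r σ ε.1 q) (n : ℤ) : fut l ε.1 n ≤ futBound σ c (q n) := by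
  have hl := h.pos
  have := nonpos_of_contraction (e := fun k : ℕ => fut l ε.1 (n + k) - futBound σ c (q (n + k)))
    (q := l⁻¹) (M := fut l (fun _ => r) 0) (by positivity) (inv_lt_one_of_one_lt₀ h.one_lt)
    (fun k => ?_) fun k => ?_
  · simpa using this
  · linarith [fut_le_of_bounded h.one_lt (h.digit_le hε) (n + k), h.futBound_pos (q (n + k))]
  · have h1 := h.futBound_step hq (n + k)
    have h2 := fut_rec hl.ne' ε.2 (n + k)
    rw [le_inv_mul_iff₀ hl]
    push_cast
    rw [← add_assoc]
    linarith

theorem fut_le_one {ε : PrimarySet l} (hε : ε ∈ symbolicCompactum l r σ) (n : ℤ) :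
    fut l ε.1 n ≤ 1 := by
  obtain ⟨q, hq⟩ := exists_labelling h.sigma_cases hε
  exact (h.fut_le_futBound hε hq n).trans (h.futBound_le_one _)

/-- To the right of the support `fut` is 0, strictly below its positive bound; the recursion carries
strictness leftwards. -/
theorem fut_lt_one {ε : PrimarySet l} (hε : ε ∈ symbolicCompactum l r σ)
    (hfin : (Function.support ε.1).Finite) (n : ℤ) : fut l ε.1 n < 1 := by
  obtain ⟨q, hq⟩ := exists_labelling h.sigma_cases hε
  have hl := h.pos
  suffices H : ∀ (k : ℕ) (n : ℤ), fut l ε.1 (n + k) < futBound σ c (q (n + k)) →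
      fut l ε.1 n < futBound σ c (q n) by
    obtain ⟨N, hN⟩ := hfin.bddAbove
    refine (H (N - n).toNat n ?_).trans_le (h.futBound_le_one _)
    have h0 : fut l ε.1 (n + (N - n).toNat) = 0 := by
      unfold fut
      refine (tsum_congr fun k => ?_).trans tsum_zero
      have : ε.1 (n + (N - n).toNat + (k + 1)) = 0 := by
        by_contra hne
        have := hN (Function.mem_support.2 hne)
        omega
      rw [this]; simp
    rw [h0]
    exact h.futBound_pos _
  intro k
  induction k with
  | zero => intro n hn; simpa using hn
  | succ k ih =>
    intro n hn
    have h1 := h.futBound_step hq n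
    have h2 := fut_rec hl.ne' ε.2 n
    have h3 := ih (n + 1) (by
      rwa [show n + 1 + (k : ℤ) = n + (k + 1 : ℕ) by push_cast; ring])
    exact lt_of_mul_lt_mul_left (by linarith) hl.le

/-- When σ = −1 the factor c is negative and exchanges lower and upper excess. Hence one common
bound `e` on both is propagated. -/
theorem pastBound_step {ε : ℤ → ℕ} {q : ℤ → Prop} (hq : IsLabelling r σ ε q) (n : ℤ) {y e : ℝ}
    (hy1 : pastLower σ l (q n) - y ≤ e) (hy2 : y - pastUpper l (q n) ≤ e) :
    pastLower σ l (q (n + 1)) - (ε (n + 1) + c * y) ≤ l⁻¹ * e ∧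
      ε (n + 1) + c * y - pastUpper l (q (n + 1)) ≤ l⁻¹ * e := by
  have h1 := h.one_lt
  have h2 := h.add_eq
  have h3 := h.mul_eq
  have hl := h.pos
  have h4 : (ε (n + 1) : ℝ) ≥ 0 := by positivity
  rw [le_inv_mul_iff₀ hl, le_inv_mul_iff₀ hl]
  have h5 : l * (ε (n + 1) + c * y) = l * ε (n + 1) + σ * y := by rw [← h3]; ring
  rw [mul_sub, mul_sub, h5]
  rcases h.step_cases hq n with ⟨hσ, hr, H⟩ | ⟨hσ, hr, H⟩ <;> subst hσ <;> push_cast at h3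
  · have h6 : l * r = l * l - 1 := by rw [← h2]; linarith
    rcases H with ⟨a, b, e⟩ | ⟨a, b, e⟩ | ⟨a, b, e⟩ <;>
      simp only [pastLower, pastUpper, a, b, if_true, if_false] at hy1 hy2 ⊢ <;>
      push_cast at hy1 hy2 ⊢ <;> constructor <;> nlinarith
  · have h6 : l * r = l * l + 1 := by rw [← h2]; linarith
    rcases H with ⟨a, b, e⟩ | ⟨a, b, e⟩ | ⟨a, b, e⟩ | ⟨a, b, e⟩ <;>
      simp only [pastLower, pastUpper, a, b, if_true, if_false] at hy1 hy2 ⊢ <;>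
      push_cast at hy1 hy2 ⊢ <;> constructor <;> nlinarith

theorem abs_past_le {ε : ℤ → ℕ} {b : ℕ} (hε : ∀ n, ε n ≤ b) (n : ℤ) :
    |past c ε n| ≤ b * (1 - |c|)⁻¹ := by
  have hs := (hasSum_geometric_of_lt_one (abs_nonneg c) h.abs_conj_lt_one).mul_left (b : ℝ)
  rw [← Real.norm_eq_abs (past c ε n)]
  refine tsum_of_norm_bounded hs fun k => ?_
  rw [norm_mul, norm_pow, Real.norm_natCast, Real.norm_eq_abs]
  gcongr
  exact hε _

theorem past_mem_Icc {ε : PrimarySet l} (hε : ε ∈ symbolicCompactum l r σ) {q : ℤ → Prop}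
    (hq : IsLabelling r σ ε.1 q) (n : ℤ) :
    pastLower σ l (q n) ≤ past c ε.1 n ∧ past c ε.1 n ≤ pastUpper l (q n) := by
  have hl := h.pos
  let e : ℤ → ℝ := fun n =>
    max (pastLower σ l (q n) - past c ε.1 n) (past c ε.1 n - pastUpper l (q n))
  have he : e n ≤ 0 := by
    have := nonpos_of_contraction (e := fun k : ℕ => e (n - k)) (q := l⁻¹)
      (M := r * (1 - |c|)⁻¹ + l + 1) (by positivity) (inv_lt_one_of_one_lt₀ h.one_lt)
      (fun k => ?_) fun k => ?_
    · simpa using this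
    · have h1 := abs_le.1 (h.abs_past_le (h.digit_le hε) (n - k))
      have h2 : pastLower σ l (q (n - k)) ≤ l + 1 := by
        unfold pastLower
        rcases h.sigma_cases with hσ | hσ <;> rw [hσ] <;> split_ifs <;> push_cast <;> linarith
      have h3 : 0 ≤ pastUpper l (q (n - k)) := by
        unfold pastUpper
        split_ifs <;> linarith [h.one_lt]
      refine max_le ?_ ?_ <;> linarith
    · have e1 : n - (k : ℤ) = n - (k + 1 : ℕ) + 1 := by push_cast; ring
      have h1 := h.pastBound_step hq (n - (k + 1 : ℕ))
        (y := past c ε.1 (n - (k + 1 : ℕ))) (le_max_left _ _) (le_max_right _ _)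
      rw [← h.past_rec ε.2, ← e1] at h1
      exact max_le h1.1 h1.2
  exact ⟨by linarith [(le_max_left _ _).trans he], by linarith [(le_max_right _ _).trans he]⟩

/-! ### Recovering the digits from future and past -/

theorem mem_quadInts_of_mul {x : ℝ} (hx : l * x ∈ quadInts l) : x ∈ quadInts l := by
  obtain ⟨⟨m, n⟩, hmn⟩ := hx
  refine ⟨(n + m * σ * r, -m * σ), ?_⟩
  refine mul_left_cancel₀ h.pos.ne' ?_
  rw [← hmn]
  push_cast
  linear_combination (-m * σ) * h.sq_eq + m * h.sigma_sq

/-- Both next digits are the integer part of l · `fut`, since the remainders lie in [0, 1). -/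
theorem digit_eq_of_fut_lt {ε ε' : PrimarySet l} {n : ℤ} (he : fut l ε.1 n = fut l ε'.1 n)
    (h1 : fut l ε.1 (n + 1) < 1) (h2 : fut l ε'.1 (n + 1) < 1) :
    ε.1 (n + 1) = ε'.1 (n + 1) ∧ fut l ε.1 (n + 1) = fut l ε'.1 (n + 1) := by
  have e1 := fut_rec h.pos.ne' ε.2 n
  have e2 := fut_rec h.pos.ne' ε'.2 n
  have p1 := fut_nonneg h.pos ε.1 (n + 1)
  have p2 := fut_nonneg h.pos ε'.1 (n + 1)
  have hd : ε.1 (n + 1) = ε'.1 (n + 1) := by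
    rw [he] at e1
    have a1 : (ε.1 (n + 1) : ℝ) < ε'.1 (n + 1) + 1 := by linarith
    have a2 : (ε'.1 (n + 1) : ℝ) < ε.1 (n + 1) + 1 := by linarith
    norm_cast at a1 a2
    omega
  refine ⟨hd, ?_⟩
  rw [he, e2, hd] at e1
  linarith

/-- Ambiguity requires some remainder equal to 1. That would put `fut` in ℤ[l], which the hypothesis
excludes at every later place as well. -/
theorem right_eq {ε ε' : PrimarySet l} (hε : ε ∈ symbolicCompactum l r σ)
    (hε' : ε' ∈ symbolicCompactum l r σ) {n : ℤ} (he : fut l ε.1 n = fut l ε'.1 n)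
    (hx : fut l ε.1 n ∉ quadInts l) (k : ℕ) : ε.1 (n + k + 1) = ε'.1 (n + k + 1) := by
  have key {ε : PrimarySet l} (hε : ε ∈ symbolicCompactum l r σ) {n : ℤ}
      (hx : fut l ε.1 n ∉ quadInts l) :
      fut l ε.1 (n + 1) < 1 ∧ fut l ε.1 (n + 1) ∉ quadInts l := by
    have e1 := fut_rec h.pos.ne' ε.2 n
    have h2 : fut l ε.1 (n + 1) ∉ quadInts l := by
      rintro ⟨⟨a, b⟩, hab⟩
      refine hx (h.mem_quadInts_of_mul ⟨(a + ε.1 (n + 1), b), ?_⟩)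
      rw [e1, ← hab]; push_cast; ring
    refine ⟨lt_of_le_of_ne (h.fut_le_one hε _) fun h1 => h2 ?_, h2⟩
    rw [h1]; exact ⟨(1, 0), by simp⟩
  induction k generalizing n with
  | zero =>
    simpa using (h.digit_eq_of_fut_lt he (key hε hx).1 (key hε' (he ▸ hx)).1).1
  | succ k ih =>
    have := ih (h.digit_eq_of_fut_lt he (key hε hx).1 (key hε' (he ▸ hx)).1).2 (key hε hx).2
    convert this using 2 <;> push_cast <;> ring

/-- With θ = −c for σ = −1 and θ = 1 for σ = 1, a digit d places `past` below d + θ, and a digit d ≥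
1 also places it above d − 1 + θ. Distinct digits thus give intervals meeting at most in an endpoint
d + θ, an element of ℤ[c]. -/
theorem past_bounds_of_digit {ε : PrimarySet l} (hε : ε ∈ symbolicCompactum l r σ) (n : ℤ) :
    past c ε.1 n ≤ ε.1 n + ((1 + σ) / 2 - (1 - σ) / 2 * c) ∧
      (1 ≤ ε.1 n → ε.1 n - 1 + ((1 + σ) / 2 - (1 - σ) / 2 * c) ≤ past c ε.1 n) := by
  obtain ⟨q, hq⟩ := exists_labelling h.sigma_cases hε
  obtain ⟨h1, h2⟩ := h.past_mem_Icc hε hq (n - 1)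
  have h3 := h.past_rec ε.2 (n - 1)
  rw [sub_add_cancel] at h3
  have hl := h.one_lt
  have hm := h.mul_eq
  rw [h3]
  rcases h.sigma_cases with hσ | hσ
  · have hlab := hq.neg hσ (n - 1)
    rw [sub_add_cancel] at hlab
    rw [hσ] at hm h1 ⊢
    push_cast at hm ⊢
    have hc : c < 0 := by nlinarith
    constructor
    · have : -1 ≤ past c ε.1 (n - 1) := by
        refine le_trans ?_ h1
        unfold pastLower
        split_ifs <;> push_cast <;> linarith
      nlinarith
    · intro hd
      have hnq : ¬ q (n - 1) := fun hqn => by have := hlab.2.2 hqn; omega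
      simp only [pastUpper, hnq, if_false] at h2
      nlinarith
  · rw [hσ] at hm h1 ⊢
    push_cast at hm ⊢
    have hc : 0 < c := by nlinarith
    have h4 : 0 ≤ past c ε.1 (n - 1) := by
      refine le_trans ?_ h1
      unfold pastLower
      split_ifs <;> push_cast <;> linarith
    have h5 : past c ε.1 (n - 1) ≤ l := by
      refine h2.trans ?_
      unfold pastUpper
      split_ifs <;> linarith
    constructor
    · nlinarith
    · intro _; nlinarith

/-- The last digit is read off from the interval containing `past` and then removed; avoiding ℤ[c]
is inherited by the remaining past. -/
theorem left_eq {ε ε' : PrimarySet l} (hε : ε ∈ symbolicCompactum l r σ)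
    (hε' : ε' ∈ symbolicCompactum l r σ) {n : ℤ} (he : past c ε.1 n = past c ε'.1 n)
    (hx : past c ε.1 n ∉ quadInts c) (k : ℕ) : ε.1 (n - k) = ε'.1 (n - k) := by
  have hθ (d : ℕ) : (d : ℝ) + ((1 + σ) / 2 - (1 - σ) / 2 * c) ∈ quadInts c := by
    rcases h.sigma_cases with hσ | hσ
    · exact ⟨(d, -1), by rw [hσ]; push_cast; ring⟩
    · exact ⟨(d + 1, 0), by rw [hσ]; push_cast; ring⟩
  have hlt {ε ε' : PrimarySet l} (hε : ε ∈ symbolicCompactum l r σ)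
      (hε' : ε' ∈ symbolicCompactum l r σ) {n : ℤ} (he : past c ε.1 n = past c ε'.1 n)
      (hx : past c ε.1 n ∉ quadInts c) : ¬ ε.1 n < ε'.1 n := by
    intro hlt
    have h1 := (h.past_bounds_of_digit hε n).1
    have h2 := (h.past_bounds_of_digit hε' n).2 (by omega)
    have h3 : (ε.1 n : ℝ) + 1 ≤ ε'.1 n := by exact_mod_cast hlt
    refine hx ?_
    rw [show past c ε.1 n = ε.1 n + ((1 + σ) / 2 - (1 - σ) / 2 * c) by linarith]
    exact hθ _
  have hd {n : ℤ} (he : past c ε.1 n = past c ε'.1 n) (hx : past c ε.1 n ∉ quadInts c) :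
      ε.1 n = ε'.1 n :=
    le_antisymm (not_lt.1 (hlt hε' hε he.symm (he ▸ hx))) (not_lt.1 (hlt hε hε' he hx))
  induction k generalizing n with
  | zero => simpa using hd he hx
  | succ k ih =>
    have e1 := h.past_rec ε.2 (n - 1)
    have e2 := h.past_rec ε'.2 (n - 1)
    rw [sub_add_cancel] at e1 e2
    have h1 : past c ε.1 (n - 1) = past c ε'.1 (n - 1) := by
      refine mul_left_cancel₀ h.conj_ne_zero ?_
      rw [he, e2, hd he hx] at e1
      linarith
    have h2 : past c ε.1 (n - 1) ∉ quadInts c := by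
      rintro ⟨⟨a, b⟩, hab⟩
      refine hx ⟨(ε.1 n - b * σ, a + b * r), ?_⟩
      rw [e1, ← hab]
      push_cast
      linear_combination (-b) * h.conj_sq_eq
    have := ih h1 h2
    convert this using 2 <;> push_cast <;> ring

/-- Elements of the symbolic compactum are determined by `fut` and `past`, outside countably
many lines. -/
theorem eq_of_fut_past {ε ε' : PrimarySet l} (hε : ε ∈ symbolicCompactum l r σ)
    (hε' : ε' ∈ symbolicCompactum l r σ) (he : fut l ε.1 0 = fut l ε'.1 0)
    (he' : past c ε.1 0 = past c ε'.1 0) (hx : fut l ε.1 0 ∉ quadInts l)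
    (hx' : past c ε.1 0 ∉ quadInts c) : ε = ε' := by
  ext n
  rcases lt_or_ge 0 n with hn | hn
  · have := h.right_eq hε hε' he hx (n - 1).toNat
    rwa [show (0 : ℤ) + (n - 1).toNat + 1 = n by omega] at this
  · have := h.left_eq hε hε' he' hx' (-n).toNat
    rwa [show (0 : ℤ) - (-n).toNat = n by omega] at this

end QuadUnit

/-! ### Injectivity on finite sequences, greedy expansions and surjectivity -/

namespace QuadUnit

variable {r : ℕ} {σ : ℤ} {l c : ℝ} (h : QuadUnit r σ l c)
include h

theorem linear_ne_zero {m n : ℤ} (hmn : (m, n) ≠ (0, 0)) : (m : ℝ) + n * l ≠ 0 := fun h0 =>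
  hmn (Prod.ext_iff.2 (h.eq_zero_of_eq_zero h0))

theorem conj_linear_ne_zero {m n : ℤ} (hmn : (m, n) ≠ (0, 0)) : (m : ℝ) + n * c ≠ 0 := fun h0 =>
  hmn (Prod.ext_iff.2 (h.conj_eq_zero_of_eq_zero h0))

theorem toralMap_leaf_fut_past (m n : ℤ) (ε : PrimarySet l) (k : ℤ) :
    toralMap (companionMatrix r σ)
      (leaf l c ((m + n * l) * fut l ε.1 k, -((m + n * c) * past c ε.1 k))) =
    leaf l c ((m + n * l) * fut l ε.1 (k + 1), -((m + n * c) * past c ε.1 (k + 1))) := by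
  have h1 := h.coding_shift m n ⟨_, translate_mem ε.2 k⟩
  have e1 (j : ℤ) : fut l (fun i => ε.1 (i + k)) j = fut l ε.1 (k + j) :=
    tsum_congr fun i => by ring_nf
  have e2 (j : ℤ) : past c (fun i => ε.1 (i + k)) j = past c ε.1 (k + j) :=
    tsum_congr fun i => by ring_nf
  unfold coding at h1
  rw [fut_shift, past_shift] at h1
  simp only [e1, e2] at h1
  simpa using h1.symm

/-- Invertibility of T moves the equality back to a place before both supports, where both pasts
vanish. The lattice vector relating the two lifts then has contracting coordinate 0, hence is 0, so
the futures agree, and remainders below 1 make the digits unique. -/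
theorem injOn_finite {m n : ℤ} (hmn : (m, n) ≠ (0, 0)) :
    Set.InjOn (coding l c m n)
      {ε | ε ∈ symbolicCompactum l r σ ∧ (Function.support ε.1).Finite} := by
  rintro ε ⟨hε, hfin⟩ ε' ⟨hε', hfin'⟩ he
  have hback (N : ℕ) : leaf l c ((m + n * l) * fut l ε.1 (-N), -((m + n * c) * past c ε.1 (-N))) =
      leaf l c ((m + n * l) * fut l ε'.1 (-N), -((m + n * c) * past c ε'.1 (-N))) := by
    induction N with
    | zero => simpa [coding] using he
    | succ N ih =>
      apply h.toralMap_companion_injective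
      simp only [h.toralMap_leaf_fut_past]
      rw [show -((N + 1 : ℕ) : ℤ) + 1 = -N by push_cast; ring]
      exact ih
  obtain ⟨a, ha⟩ := hfin.bddBelow
  obtain ⟨b, hb⟩ := hfin'.bddBelow
  let N : ℕ := (1 - min a b).toNat
  have z1 (k : ℤ) (hk : k ≤ -N) : ε.1 k = 0 := by
    by_contra hne
    have := ha (Function.mem_support.2 hne)
    omega
  have z2 (k : ℤ) (hk : k ≤ -N) : ε'.1 k = 0 := by
    by_contra hne
    have := hb (Function.mem_support.2 hne)
    omega
  have p1 : past c ε.1 (-N) = 0 :=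
    (tsum_congr fun k => by rw [z1 _ (by omega)]; simp).trans tsum_zero
  have p2 : past c ε'.1 (-N) = 0 :=
    (tsum_congr fun k => by rw [z2 _ (by omega)]; simp).trans tsum_zero
  have hN := hback N
  rw [p1, p2, h.leaf_eq_iff] at hN
  obtain ⟨u, v, huv⟩ := hN
  have h1 := congrArg Prod.fst huv
  have h2 := congrArg Prod.snd huv
  simp only [mul_zero, neg_zero, Prod.mk_add_mk, zero_add] at h1 h2
  obtain ⟨rfl, rfl⟩ := h.conj_eq_zero_of_eq_zero h2.symm
  have hfut : fut l ε.1 (-N) = fut l ε'.1 (-N) :=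
    mul_left_cancel₀ (h.linear_ne_zero hmn) (by simpa using h1)
  have hall (k : ℕ) : fut l ε.1 (-N + k) = fut l ε'.1 (-N + k) := by
    induction k with
    | zero => simpa using hfut
    | succ k ih =>
      have := (h.digit_eq_of_fut_lt ih (h.fut_lt_one hε hfin _) (h.fut_lt_one hε' hfin' _)).2
      push_cast
      rwa [← add_assoc]
  ext k
  rcases le_or_gt k (-N) with hk | hk
  · rw [z1 k hk, z2 k hk]
  · have := (h.digit_eq_of_fut_lt (hall (k + N - 1).toNat) (h.fut_lt_one hε hfin _)
      (h.fut_lt_one hε' hfin' _)).1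
    rwa [show -(N : ℤ) + (k + N - 1).toNat + 1 = k by omega] at this

/-- The greedy expansion: every `x ∈ [0, 1)` is `fut` of an element of the symbolic compactum
without digits at nonpositive places. -/
theorem exists_greedy {x : ℝ} (hx0 : 0 ≤ x) (hx1 : x < 1) :
    ∃ ε ∈ symbolicCompactum l r σ, fut l ε.1 0 = x ∧ past c ε.1 0 = 0 := by
  have hl := h.pos
  have hl1 := h.one_lt
  have hadd := h.add_eq
  have hmul := h.mul_eq
  let g : ℝ → ℝ := fun y => Int.fract (l * y)
  let y : ℕ → ℝ := fun k => g^[k] x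
  have hy (k : ℕ) : 0 ≤ y k ∧ y k < 1 := by
    cases k with
    | zero => exact ⟨hx0, hx1⟩
    | succ k =>
      simp only [y, Function.iterate_succ_apply', g]
      exact ⟨Int.fract_nonneg _, Int.fract_lt_one _⟩
  let d : ℕ → ℕ := fun k => ⌊l * y k⌋₊
  have hd (k : ℕ) : l * y k = d k + y (k + 1) := by
    have e1 : y (k + 1) = Int.fract (l * y k) := by simp only [y, Function.iterate_succ_apply', g]
    have e2 := natCast_floor_eq_intCast_floor (mul_nonneg hl.le (hy k).1)
    rw [e1, e2, Int.floor_add_fract]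
  let ε : ℤ → ℕ := fun n => if 0 < n then d (n - 1).toNat else 0
  have hεd (n : ℤ) (hn : 0 < n) : ∃ k : ℕ, n = k + 1 ∧ ε n = d k :=
    ⟨(n - 1).toNat, by omega, by simp [ε, hn]⟩
  have hεk (k : ℕ) : ε (k + 1) = d k := by simp [ε, show (0 : ℤ) < k + 1 by omega]
  have hc := abs_lt.1 h.abs_conj_lt_one
  have hdl (k : ℕ) : (d k : ℝ) < l := by nlinarith [hy k, hy (k + 1), hd k]
  have hdr (k : ℕ) : d k ≤ r := by
    have : (d k : ℝ) < r + 1 := by linarith [hdl k]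
    have : d k < r + 1 := by exact_mod_cast this
    omega
  have hεr (n : ℤ) : ε n ≤ r := by
    simp only [ε]; split_ifs
    · exact hdr _
    · omega
  have hmem : ε ∈ PrimarySet l := mem_of_bounded hl1 hεr
  refine ⟨⟨ε, hmem⟩, ⟨fun hσ n => ⟨hεr n, fun hn => ?_⟩, fun hσ => ⟨fun n => ?_, ?_⟩⟩, ?_, ?_⟩
  · have hr := (h.cases.resolve_right (by omega)).2
    obtain ⟨k, rfl, hk⟩ := hεd n (by
      by_contra hneg
      simp only [ε, hneg, if_false] at hn
      omega)
    have e1 := hd k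
    have e2 := hd (k + 1)
    have := hεk (k + 1)
    push_cast at this
    simp only at hn ⊢
    rw [this]
    rw [hk] at hn
    rw [hn] at e1
    rw [hσ] at hmul
    push_cast at hmul
    -- After a digit r the remainder is below l − r = −c = 1/l, so the next digit is 0.
    have h3 : y (k + 1) < -c := by nlinarith [hy k]
    have h4 : (d (k + 1) : ℝ) < 1 := by nlinarith [hy (k + 2)]
    have : d (k + 1) < 1 := by exact_mod_cast h4
    omega
  · have hr := (h.cases.resolve_left (by omega)).2
    rw [hσ] at hmul
    push_cast at hmul
    simp only [ε]; split_ifs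
    · have h1 : (d (n - 1).toNat : ℝ) < r := by nlinarith [hdl (n - 1).toNat]
      exact_mod_cast h1
    · omega
  · have hr := (h.cases.resolve_left (by omega)).2
    have hrR : (3 : ℝ) ≤ r := by exact_mod_cast hr
    rw [hσ] at hmul
    push_cast at hmul
    have hc0 : 0 < c := by nlinarith
    rintro n j ⟨b1, b2, b3⟩
    obtain ⟨k, rfl, hk⟩ := hεd n (by
      by_contra hneg
      simp only [ε, hneg, if_false] at b1
      omega)
    simp only at b1 b2 b3
    -- The bound 1 − c holds after a digit r − 1 and is reproduced by a digit r − 2, because l(1 −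
    -- c) − (r − 2) = 1 − c. As l(1 − c) = l − 1 < r − 1, no closing digit r − 1 can follow.
    have hbound (i : ℕ) (hi : i ≤ j) : y (k + i + 1) < 1 - c := by
      induction i with
      | zero =>
        have e1 := hd k
        have : (d k : ℝ) + 1 = r := by rw [hk] at b1; exact_mod_cast b1
        simp only [add_zero]
        nlinarith [hy k]
      | succ i ih =>
        have e1 := hd (k + i + 1)
        have : (d (k + i + 1) : ℝ) + 2 = r := by
          have e2 := b2 (i + 1) (by omega) hi
          have e3 := hεk (k + i + 1)
          push_cast at e2 e3
          rw [show (k : ℤ) + 1 + (i + 1) = k + i + 1 + 1 by ring, e3] at e2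
          exact_mod_cast e2
        rw [← add_assoc]
        nlinarith [ih (by omega)]
    have e1 := hd (k + j + 1)
    have : (d (k + j + 1) : ℝ) + 1 = r := by
      have e3 := hεk (k + j + 1)
      push_cast at e3
      rw [show (k : ℤ) + 1 + j + 1 = k + j + 1 + 1 by ring, e3] at b3
      exact_mod_cast b3
    nlinarith [hbound j le_rfl, hy (k + j + 1 + 1)]
  · have hpart (N : ℕ) : ∑ k ∈ Finset.range N, (ε (0 + (k + 1)) : ℝ) / l ^ (k + 1) =
        x - y N * (l⁻¹) ^ N := by
      induction N with
      | zero => simp [y]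
      | succ N ih =>
        rw [Finset.sum_range_succ, ih, zero_add, hεk]
        have := hd N
        rw [eq_comm, sub_eq_iff_eq_add, ← sub_eq_iff_eq_add']
        rw [show (d N : ℝ) = l * y N - y (N + 1) by linarith]
        simp only [inv_pow]
        field_simp
        ring
    have ht : Tendsto (fun N : ℕ => x - y N * (l⁻¹) ^ N) atTop (𝓝 (x - 0)) := by
      refine tendsto_const_nhds.sub (squeeze_zero (fun N => ?_) (fun N => ?_)
        (tendsto_pow_atTop_nhds_zero_of_lt_one (inv_nonneg.2 hl.le) (inv_lt_one_of_one_lt₀ hl1)))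
      · exact mul_nonneg (hy N).1 (by positivity)
      · exact mul_le_of_le_one_left (by positivity) (hy N).2.le
    rw [sub_zero] at ht
    refine HasSum.tsum_eq ((hasSum_iff_tendsto_nat_of_nonneg (fun k => by positivity) x).2 ?_)
    simpa only [hpart] using ht
  · refine (tsum_congr fun k => ?_).trans tsum_zero
    have : ε (0 - k) = 0 := by simp [ε]
    simp only [this]; simp

theorem isCompact_of_isClosed_subset {Y : Set (PrimarySet l)} (hY : IsClosed Y)
    (hsub : Y ⊆ symbolicCompactum l r σ) : IsCompact Y :=
  (isCompact_le_const h.one_lt r).of_isClosed_subset hY fun _ hε => h.digit_le (hsub hε)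

theorem isCompact_image_coding (m n : ℤ) {Y : Set (PrimarySet l)} (hY : IsClosed Y)
    (hsub : Y ⊆ symbolicCompactum l r σ) : IsCompact (coding l c m n '' Y) :=
  (h.isCompact_of_isClosed_subset hY hsub).image_of_continuousOn
    ((h.continuousOn_coding m n (constSeq h.one_lt r)).mono fun _ hε => h.digit_le (hsub hε))

theorem toralMap_mulMatrix_surjective {m n : ℤ} (hmn : (m, n) ≠ (0, 0)) :
    Function.Surjective (toralMap (mulMatrix r σ m n)) := by
  intro t
  obtain ⟨⟨x, y⟩, rfl⟩ := h.leaf_surjective t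
  have h1 := h.linear_ne_zero hmn
  have h2 := h.conj_linear_ne_zero hmn
  refine ⟨leaf l c (x / (m + n * l), y / (m + n * c)), ?_⟩
  rw [h.toralMap_mulMatrix, mul_div_cancel₀ _ h1, mul_div_cancel₀ _ h2]

theorem coding_surjOn {m n : ℤ} (hmn : (m, n) ≠ (0, 0)) :
    coding l c m n '' symbolicCompactum l r σ = Set.univ := by
  have hl := h.pos
  have h0 : coding l c 1 0 '' symbolicCompactum l r σ = Set.univ := by
    have hcl : IsClosed (coding l c 1 0 '' symbolicCompactum l r σ) :=
      (h.isCompact_image_coding 1 0 (isClosed_symbolicCompactum l r σ) subset_rfl).isClosed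
    rw [Set.eq_univ_iff_forall]
    intro t
    rw [← hcl.closure_eq]
    have ht : t ∈ closure {t | ∃ x : ℝ, 0 ≤ x ∧ t = leaf l c (x, 0)} := by
      rw [h.closure_halfLeaf]; trivial
    refine closure_mono ?_ ht
    rintro _ ⟨x, hx, rfl⟩
    -- A point of the expanding half-leaf is scaled into [0, 1), expanded greedily and carried back
    -- by k shifts.
    obtain ⟨k, hk⟩ := pow_unbounded_of_one_lt x h.one_lt
    obtain ⟨ε, hε, hf, hp⟩ := h.exists_greedy (x := x / l ^ k) (by positivity)
      ((div_lt_one (by positivity)).2 hk)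
    have hit : coding l c 1 0 (shift^[k] ε) = leaf l c (x, 0) ∧
        shift^[k] ε ∈ symbolicCompactum l r σ := by
      have : ∀ j : ℕ, coding l c 1 0 (shift^[j] ε) =
          (toralMap (companionMatrix r σ))^[j] (leaf l c (x / l ^ k, 0)) ∧
          shift^[j] ε ∈ symbolicCompactum l r σ := by
        intro j
        induction j with
        | zero => simp [coding, hf, hp, hε]
        | succ j ih =>
          rw [Function.iterate_succ_apply', Function.iterate_succ_apply', h.coding_shift, ih.1]
          exact ⟨rfl, (shift_mem_symbolicCompactum _).2 ih.2⟩
      refine ⟨?_, (this k).2⟩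
      rw [(this k).1, h.iterate_toralMap_companion]
      congr 2
      · simp only; field_simp
      · simp
    exact ⟨_, hit.2, hit.1⟩
  rw [Set.eq_univ_iff_forall]
  intro t
  obtain ⟨s, rfl⟩ := h.toralMap_mulMatrix_surjective hmn t
  obtain ⟨ε, hε, rfl⟩ := h0.symm ▸ Set.mem_univ s
  exact ⟨ε, hε, h.coding_eq_toralMap m n ε⟩

end QuadUnit

theorem QuadUnit.isArithmeticCoding {r : ℕ} {σ : ℤ} {c : ℝ}
    (h : QuadUnit r σ (eigenLam (companionMatrix r σ)) c) {m n : ℤ} (hmn : (m, n) ≠ (0, 0)) :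
    IsArithmeticCoding (companionMatrix r σ) (coding _ c m n) (symbolicCompactum _ r σ) :=
  ⟨h.coding_add m n, h.continuousOn_coding m n, h.coding_shift m n,
    isClosed_symbolicCompactum _ r σ, shift_mem_symbolicCompactum,
    isTotalSet_symbolicCompactum _ r σ, h.coding_surjOn hmn, h.injOn_finite hmn⟩

/-! ### Almost everywhere statements and the tiling argument -/

theorem ae_torus_of_ae {Q : Torus2 → Prop}
    (hQ : ∀ᵐ z : Fin 2 → ℝ, Q fun i => (z i : UnitAddCircle)) : ∀ᵐ t : Torus2, Q t := by
  have h1 : MeasurePreserving (fun t : UnitAddCircle => ((AddCircle.equivIoc 1 0 t : _) : ℝ))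
      volume (volume.restrict (Set.Ioc (0 : ℝ) (0 + 1))) :=
    (measurePreserving_subtype_coe measurableSet_Ioc).comp
      (AddCircle.measurePreserving_equivIoc (T := (1 : ℝ)) (a := 0))
  have h2 := measurePreserving_pi (ι := Fin 2) _ _ fun _ => h1
  rw [← Measure.restrict_pi_pi] at h2
  have h3 := h2.quasiMeasurePreserving.ae (ae_restrict_of_ae hQ)
  refine h3.mono fun t ht => ?_
  convert ht using 1
  ext i
  exact ((AddCircle.equivIoc 1 0).symm_apply_apply (t i)).symm

/-- The number of integer translates of a point lying in S has integral `volume S` ≤ 1 over the unit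
square, yet is at least 1 everywhere. So it is 1 almost everywhere. -/
theorem ae_existsUnique_translate {S : Set (Fin 2 → ℝ)} (hS : MeasurableSet S)
    (hvol : volume S ≤ 1) (hcov : ∀ z : Fin 2 → ℝ, ∃ k : Fin 2 → ℤ, (fun i => z i + k i) ∈ S) :
    ∀ᵐ z : Fin 2 → ℝ, ∃! k : Fin 2 → ℤ, (fun i => z i + k i) ∈ S := by
  let v : (Fin 2 → ℤ) → (Fin 2 → ℝ) := fun k i => k i
  let D : Set (Fin 2 → ℝ) := {z | ∀ i, ⌊z i⌋ = 0}
  have hDpi : D = Set.univ.pi fun _ => Set.Ico 0 1 := by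
    ext z; simp [D, Int.floor_eq_zero_iff]
  have hDm : MeasurableSet D := hDpi ▸ MeasurableSet.univ_pi fun _ => measurableSet_Ico
  have hD1 : volume D = 1 := by rw [hDpi, Real.volume_pi_Ico]; simp
  -- S is cut along the integer cells and every piece is translated into the unit square.
  have hint : ∫⁻ z in D, ∑' k, S.indicator 1 (z + v k) = volume S := by
    have hm (k : Fin 2 → ℤ) : Measurable fun z : Fin 2 → ℝ =>
        S.indicator (1 : (Fin 2 → ℝ) → ENNReal) (z + v k) :=
      (measurable_one.indicator hS).comp (measurable_add_const (v k))
    rw [lintegral_tsum fun k => (hm k).aemeasurable]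
    have hcell : S = ⋃ k : Fin 2 → ℤ, S ∩ {z | ∀ i, ⌊z i⌋ = k i} := by
      ext z
      simp only [Set.mem_iUnion, Set.mem_inter_iff, Set.mem_ofPred_eq]
      exact ⟨fun hz => ⟨fun i => ⌊z i⌋, hz, fun _ => rfl⟩, fun ⟨_, hz, _⟩ => hz⟩
    have hcm (k : Fin 2 → ℤ) : MeasurableSet {z : Fin 2 → ℝ | ∀ i, ⌊z i⌋ = k i} := by
      have : {z : Fin 2 → ℝ | ∀ i, ⌊z i⌋ = k i} =
          Set.univ.pi fun i => Set.Ico (k i : ℝ) (k i + 1) := by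
        ext z; simp [Int.floor_eq_iff]
      rw [this]
      exact MeasurableSet.univ_pi fun _ => measurableSet_Ico
    conv_rhs => rw [hcell]
    rw [measure_iUnion ?_ fun k => hS.inter (hcm k)]
    · refine tsum_congr fun k => ?_
      have e1 : (fun z => S.indicator (1 : (Fin 2 → ℝ) → ENNReal) (z + v k)) =
          ((· + v k) ⁻¹' S).indicator 1 := by
        rfl
      have hSk : MeasurableSet ((· + v k) ⁻¹' S) := measurable_add_const (v k) hS
      rw [e1, lintegral_indicator_one hSk, Measure.restrict_apply hSk,
        ← measure_preimage_add_right volume (v k) (S ∩ _)]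
      congr 1
      ext z
      simp [D, v]
    · intro k k' hkk'
      refine Set.disjoint_left.2 fun z hz hz' => hkk' ?_
      ext i
      rw [← hz.2 i, hz'.2 i]
  have hf1 (z : Fin 2 → ℝ) : 1 ≤ ∑' k, S.indicator (1 : (Fin 2 → ℝ) → ENNReal) (z + v k) := by
    obtain ⟨k, hk⟩ := hcov z
    refine le_trans ?_ (ENNReal.le_tsum k)
    rw [Set.indicator_of_mem (show z + v k ∈ S from hk)]
    rfl
  have hae : ∀ᵐ z ∂volume.restrict D,
      (1 : ENNReal) = ∑' k, S.indicator (1 : (Fin 2 → ℝ) → ENNReal) (z + v k) := by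
    refine ae_eq_of_ae_le_of_lintegral_le (Eventually.of_forall hf1) ?_ ?_ ?_
    · simp [hD1]
    · exact (Measurable.tsum fun k => (measurable_one.indicator hS).comp
        (measurable_add_const (v k))).aemeasurable
    · rw [hint]; simpa [hD1] using hvol
  have hgood : ∀ᵐ z ∂volume.restrict D, ∃! k : Fin 2 → ℤ, (fun i => z i + (k i : ℝ)) ∈ S := by
    refine hae.mono fun z hz => ?_
    obtain ⟨k, hk⟩ := hcov z
    refine ⟨k, hk, fun k' hk' => ?_⟩
    by_contra hne
    have := ENNReal.sum_le_tsum (f := fun k => S.indicator (1 : (Fin 2 → ℝ) → ENNReal) (z + v k))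
      {k, k'}
    rw [Finset.sum_pair (Ne.symm hne), ← hz, Set.indicator_of_mem (show z + v k ∈ S from hk),
      Set.indicator_of_mem (show z + v k' ∈ S from hk')] at this
    norm_num at this
  rw [ae_restrict_iff' hDm] at hgood
  have hall : ∀ᵐ z : Fin 2 → ℝ, ∀ j : Fin 2 → ℤ, z + v j ∈ D →
      ∃! k : Fin 2 → ℤ, (fun i => (z + v j) i + k i) ∈ S :=
    ae_all_iff.2 fun j =>
      (measurePreserving_add_right volume (v j)).quasiMeasurePreserving.ae hgood
  refine hall.mono fun z hz => ?_
  obtain ⟨k, hk, huniq⟩ := hz (fun i => -⌊z i⌋) (by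
    intro i
    change ⌊z i + ((-⌊z i⌋ : ℤ) : ℝ)⌋ = 0
    rw [Int.floor_add_intCast, add_neg_cancel])
  refine ⟨fun i => k i - ⌊z i⌋, ?_, fun k' hk' => ?_⟩
  · convert hk using 1
    ext i
    simp [v]; ring
  · have e : (fun i => (z + v fun i => -⌊z i⌋) i + ((k' i + ⌊z i⌋ : ℤ) : ℝ)) =
        fun i => z i + k' i := by
      ext i; simp [v]; ring
    have hmem : (fun i => (z + v fun i => -⌊z i⌋) i + ((k' i + ⌊z i⌋ : ℤ) : ℝ)) ∈ S := by
      rw [e]; exact hk'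
    have := huniq (fun i => k' i + ⌊z i⌋) hmem
    ext i
    rw [← congrFun this i]; simp

theorem ae_notMem_countable (i : Fin 2) {s : Set ℝ} (hs : s.Countable) :
    ∀ᵐ w : Fin 2 → ℝ, w i ∉ s :=
  (Measure.quasiMeasurePreserving_eval (fun _ : Fin 2 => (volume : Measure ℝ)) i).ae
    (measure_eq_zero_iff_ae_notMem.1 (hs.measure_zero volume))

/-- A nonsingular linear substitution preserves almost everywhere statements. -/
theorem ae_mulVec {M : Matrix (Fin 2) (Fin 2) ℝ} (hM : M.det ≠ 0) {Q : (Fin 2 → ℝ) → Prop}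
    (hQ : ∀ᵐ w, Q w) : ∀ᵐ w, Q (M.mulVec w) := by
  have := (Measure.LinearMap.quasiMeasurePreserving (volume : Measure (Fin 2 → ℝ))
    (Matrix.toLin' M) (by rwa [LinearMap.det_toLin'])).ae hQ
  simpa using this

namespace QuadUnit

variable {r : ℕ} {σ : ℤ} {l c : ℝ} (h : QuadUnit r σ l c)
include h

theorem leaf_mulVec (z : Fin 2 → ℝ) :
    leaf l c (l * z 0 + z 1, c * z 0 + z 1) = fun i => (z i : UnitAddCircle) := by
  have hs := h.sub_pos.ne'
  ext i
  fin_cases i <;> simp only [leaf_apply, Fin.zero_eta, Fin.mk_one, Matrix.cons_val_zero,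
    Matrix.cons_val_one] <;> congr 1 <;> field_simp <;> ring

theorem ae_torus_of_ae_leaf {Q : Torus2 → Prop}
    (hQ : ∀ᵐ w : Fin 2 → ℝ, Q (leaf l c (w 0, w 1))) : ∀ᵐ t : Torus2, Q t := by
  refine ae_torus_of_ae ?_
  have := ae_mulVec (M := !![l, 1; c, 1]) (by
    rw [Matrix.det_fin_two_of]; linarith [h.sub_pos]) hQ
  refine this.mono fun z hz => ?_
  rw [← h.leaf_mulVec]
  simpa [Matrix.mulVec, dotProduct, Fin.sum_univ_two] using hz

theorem ae_leaf_of_ae {Q : Torus2 → Prop}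
    (hQ : ∀ᵐ z : Fin 2 → ℝ, Q fun i => (z i : UnitAddCircle)) :
    ∀ᵐ w : Fin 2 → ℝ, Q (leaf l c (w 0, w 1)) := by
  have hs := h.sub_pos.ne'
  have := ae_mulVec (M := !![1 / (l - c), -(1 / (l - c)); -c / (l - c), l / (l - c)]) (by
    rw [Matrix.det_fin_two_of]
    have : 1 / (l - c) * (l / (l - c)) - -(1 / (l - c)) * (-c / (l - c)) = 1 / (l - c) := by
      field_simp
    rw [this]
    exact one_div_ne_zero hs) hQ
  refine this.mono fun w hw => ?_
  have e : Matrix.mulVec !![1 / (l - c), -(1 / (l - c)); -c / (l - c), l / (l - c)] w =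
      ![(w 0 - w 1) / (l - c), (-c * w 0 + l * w 1) / (l - c)] := by
    ext i
    fin_cases i <;> simp [Matrix.mulVec, dotProduct, Fin.sum_univ_two] <;> ring
  rw [e] at hw
  convert hw using 1
  ext i
  fin_cases i <;> rfl

/-- Almost every point of the torus has exactly one preimage in the symbolic compactum. -/
theorem ae_existsUnique_coding :
    ∀ᵐ w : Fin 2 → ℝ, ∃! ε, ε ∈ symbolicCompactum l r σ ∧
      coding l c 1 0 ε = leaf l c (w 0, w 1) := by
  have hs := h.sub_pos
  refine h.ae_leaf_of_ae (Q := fun t => ∃! ε, ε ∈ symbolicCompactum l r σ ∧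
      coding l c 1 0 ε = t) ?_
  -- One rectangle per automaton state for (`fut`, −`past`). Their areas l − 1 − (σ − 1)/2 and (1 +
  -- σ)/2 − c add up to l − c, the covolume of the lattice, so the linear preimage `S` below has
  -- volume at most 1.
  let R (q : Prop) : Set (Fin 2 → ℝ) :=
    Set.Icc ![0, -pastUpper l q] ![futBound σ c q, -pastLower σ l q]
  let S₀ := R False ∪ R True
  have hS₀m : MeasurableSet S₀ := measurableSet_Icc.union measurableSet_Icc
  have hS₀v : volume S₀ ≤ ENNReal.ofReal (l - c) := by
    have e1 : volume (R False) = ENNReal.ofReal (l - 1 - (σ - 1) / 2) := by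
      simp only [R, Real.volume_Icc_pi, Fin.prod_univ_two, Matrix.cons_val_zero,
        Matrix.cons_val_one, futBound, pastLower, pastUpper, if_false]
      simp; congr 1; ring
    have e2 : volume (R True) = ENNReal.ofReal ((1 + σ) / 2 - c) := by
      simp only [R, Real.volume_Icc_pi, Fin.prod_univ_two, Matrix.cons_val_zero,
        Matrix.cons_val_one, futBound, pastLower, pastUpper, if_true]
      simp
    have h0 : (0 : ℝ) ≤ (1 + σ) / 2 - c := by
      simpa [futBound] using (h.futBound_pos True).le
    have h1 : (0 : ℝ) ≤ l - 1 - (σ - 1) / 2 := by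
      have := h.one_lt
      rcases h.sigma_cases with hσ | hσ <;> rw [hσ] <;> push_cast <;> linarith
    refine (measure_union_le _ _).trans ?_
    rw [e1, e2, ← ENNReal.ofReal_add h1 h0]
    refine ENNReal.ofReal_le_ofReal (le_of_eq ?_)
    ring
  have hmem {ε : PrimarySet l} (hε : ε ∈ symbolicCompactum l r σ) :
      ![fut l ε.1 0, -past c ε.1 0] ∈ S₀ := by
    obtain ⟨q, hq⟩ := exists_labelling h.sigma_cases hε
    have h1 := h.fut_le_futBound hε hq 0
    have h2 := h.past_mem_Icc hε hq 0
    have h3 := fut_nonneg h.pos ε.1 0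
    have h4 : ![fut l ε.1 0, -past c ε.1 0] ∈ R (q 0) := by
      refine ⟨fun i => ?_, fun i => ?_⟩ <;> fin_cases i <;> simp <;> linarith
    by_cases hq0 : q 0
    · right; simpa only [hq0] using h4
    · left; simpa only [hq0] using h4
  let M : Matrix (Fin 2) (Fin 2) ℝ := !![l, 1; c, 1]
  have hdet : M.det = l - c := by rw [Matrix.det_fin_two_of]; ring
  have hMv (z : Fin 2 → ℝ) : M.mulVec z = ![l * z 0 + z 1, c * z 0 + z 1] := by
    ext i; fin_cases i <;> simp [M, Matrix.mulVec, dotProduct, Fin.sum_univ_two]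
  let S : Set (Fin 2 → ℝ) := (Matrix.toLin' M) ⁻¹' S₀
  have hSm : MeasurableSet S :=
    (LinearMap.continuous_of_finiteDimensional (Matrix.toLin' M)).measurable hS₀m
  have hSv : volume S ≤ 1 := by
    have hd : LinearMap.det (Matrix.toLin' M) = l - c := by rw [LinearMap.det_toLin', hdet]
    rw [Measure.addHaar_preimage_linearMap _ (by rw [hd]; exact hs.ne'), hd]
    calc _ ≤ ENNReal.ofReal |(l - c)⁻¹| * ENNReal.ofReal (l - c) := by gcongr
      _ = 1 := by
        rw [abs_of_pos (inv_pos.2 hs), ← ENNReal.ofReal_mul (inv_pos.2 hs).le,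
          inv_mul_cancel₀ hs.ne', ENNReal.ofReal_one]
  have hfib {ε : PrimarySet l} {z : Fin 2 → ℝ}
      (he : coding l c 1 0 ε = fun i => (z i : UnitAddCircle)) :
      ∃ k : Fin 2 → ℤ, fut l ε.1 0 = l * (z 0 + k 0) + (z 1 + k 1) ∧
        -past c ε.1 0 = c * (z 0 + k 0) + (z 1 + k 1) := by
    rw [← h.leaf_mulVec, coding, h.leaf_eq_iff] at he
    obtain ⟨m, n, hmn⟩ := he
    have h1 := congrArg Prod.fst hmn
    have h2 := congrArg Prod.snd hmn
    simp at h1 h2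
    refine ⟨![n, m], ?_, ?_⟩
    · rw [h1]; simp; ring
    · rw [h2]; simp; ring
  have hS {ε : PrimarySet l} (hε : ε ∈ symbolicCompactum l r σ) {z : Fin 2 → ℝ} {k : Fin 2 → ℤ}
      (h1 : fut l ε.1 0 = l * (z 0 + k 0) + (z 1 + k 1))
      (h2 : -past c ε.1 0 = c * (z 0 + k 0) + (z 1 + k 1)) : (fun i => z i + k i) ∈ S := by
    simp only [S, Set.mem_preimage, Matrix.toLin'_apply, hMv]
    rw [← h1, ← h2]
    exact hmem hε
  have hex (z : Fin 2 → ℝ) : ∃ ε ∈ symbolicCompactum l r σ,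
      coding l c 1 0 ε = fun i => (z i : UnitAddCircle) := by
    have := h.coding_surjOn (m := 1) (n := 0) (by simp)
    exact (Set.ext_iff.1 this _).2 trivial
  have hcov (z : Fin 2 → ℝ) : ∃ k : Fin 2 → ℤ, (fun i => z i + k i) ∈ S := by
    obtain ⟨ε, hε, he⟩ := hex z
    obtain ⟨k, h1, h2⟩ := hfib he
    exact ⟨k, hS hε h1 h2⟩
  have hne : M.det ≠ 0 := hdet ▸ hs.ne'
  filter_upwards [ae_existsUnique_translate hSm hSv hcov,
    ae_mulVec hne (ae_notMem_countable 0 (countable_quadInts l)),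
    ae_mulVec hne (ae_notMem_countable 1 (countable_quadInts c))] with z hz hz0 hz1
  simp only [hMv, Matrix.cons_val_zero, Matrix.cons_val_one] at hz0 hz1
  obtain ⟨ε, hε, he⟩ := hex z
  refine ⟨ε, ⟨hε, he⟩, fun ε' ⟨hε', he'⟩ => ?_⟩
  obtain ⟨k, h1, h2⟩ := hfib he
  obtain ⟨k', h1', h2'⟩ := hfib he'
  -- The tiling gives both sequences the same lift, hence the same `fut` and `past`; the exceptional
  -- lines are invariant under integer translation and were removed.
  obtain rfl := hz.unique (hS hε h1 h2) (hS hε' h1' h2')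
  refine (h.eq_of_fut_past hε hε' (h1.trans h1'.symm) (neg_injective (h2.trans h2'.symm)) ?_ ?_).symm
  · rintro ⟨⟨a, b⟩, hab⟩
    refine hz0 ⟨(a - k 1, b - k 0), ?_⟩
    rw [h1] at hab
    push_cast at hab ⊢; linarith
  · rintro ⟨⟨a, b⟩, hab⟩
    refine hz1 ⟨(-a - k 1, -b - k 0), ?_⟩
    simp only at hab
    push_cast
    linarith

end QuadUnit

/-! ### Multiplication by m + nl on the torus and the size of fibres -/

namespace QuadUnit

variable {r : ℕ} {σ : ℤ} {l c : ℝ} (h : QuadUnit r σ l c)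
include h

/-- The fibres of multiplication by `m + n l ≠ 0` on the torus have `|N(m + n l)|` elements. -/
theorem ncard_fiber {m n : ℤ} (hmn : (m, n) ≠ (0, 0)) (t : Torus2) :
    {y | toralMap (mulMatrix r σ m n) y = t}.ncard = (m * m + m * n * r + n * n * σ).natAbs := by
  have h1 := h.linear_ne_zero hmn
  have h2 := h.conj_linear_ne_zero hmn
  obtain ⟨y₀, rfl⟩ := h.toralMap_mulMatrix_surjective hmn t
  -- The kernel of the multiplication is the image of the fractions (k₀ + k₁l)/(m + nl), so its
  -- order is the index of the kernel of `g`.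
  let g : (Fin 2 → ℤ) →+ Torus2 := AddMonoidHom.mk'
    (fun k => leaf l c (((k 0 : ℝ) + k 1 * l) / (m + n * l), ((k 0 : ℝ) + k 1 * c) / (m + n * c)))
    fun k k' => by
      rw [← map_add]; congr 1; ext <;> simp <;> ring
  have hfib : {y | toralMap (mulMatrix r σ m n) y = toralMap (mulMatrix r σ m n) y₀} =
      (y₀ + ·) '' (g.range : Set Torus2) := by
    ext y
    simp only [Set.mem_ofPred_eq, Set.mem_image, SetLike.mem_coe, AddMonoidHom.mem_range]
    constructor
    · intro hy
      refine ⟨y - y₀, ?_, by abel⟩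
      have h0 : toralMap (mulMatrix r σ m n) (y - y₀) = 0 := by
        have := (toralHom (mulMatrix r σ m n)).map_sub y y₀
        exact this.trans (sub_eq_zero.2 hy)
      obtain ⟨⟨p, q⟩, hp⟩ := h.leaf_surjective (y - y₀)
      rw [← hp, h.toralMap_mulMatrix, h.leaf_eq_zero_iff] at h0
      obtain ⟨a, b, hab⟩ := h0
      refine ⟨![a, b], ?_⟩
      rw [← hp]
      have e1 := congrArg Prod.fst hab
      have e2 := congrArg Prod.snd hab
      simp only at e1 e2
      simp only [g, AddMonoidHom.mk'_apply, Matrix.cons_val_zero, Matrix.cons_val_one, ← e1, ← e2]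
      rw [mul_div_cancel_left₀ _ h1, mul_div_cancel_left₀ _ h2]
    · rintro ⟨_, ⟨k, rfl⟩, rfl⟩
      rw [toralMap_add]
      simp only [g, AddMonoidHom.mk'_apply, h.toralMap_mulMatrix]
      rw [mul_div_cancel₀ _ h1, mul_div_cancel₀ _ h2, (h.leaf_eq_zero_iff _).2 ⟨k 0, k 1, rfl⟩,
        add_zero]
  have hN : m * m + m * n * r + n * n * σ ≠ 0 := by
    intro h0
    have := h.norm_eq m n
    rw [h0] at this
    exact mul_ne_zero h1 h2 (by simpa using this)
  -- The matrix of multiplication by m + nl in the basis 1, l: its range is the kernel of `g`, and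
  -- its determinant is the norm.
  let A : Matrix (Fin 2) (Fin 2) ℤ := !![m, -n * σ; n, m + n * r]
  have hA : A.det = m * m + m * n * r + n * n * σ := by rw [Matrix.det_fin_two_of]; ring
  have hAv (k : Fin 2 → ℤ) : Matrix.toLin' A k =
      ![m * k 0 + -n * σ * k 1, n * k 0 + (m + n * r) * k 1] := by
    ext i; fin_cases i <;> simp [A, Matrix.mulVec, dotProduct, Fin.sum_univ_two]
  have hinj : Function.Injective (Matrix.toLin' A) :=
    Matrix.mulVec_injective_of_det_ne_zero (hA ▸ hN)
  have hker : g.ker = (LinearMap.range (Matrix.toLin' A)).toAddSubgroup := by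
    ext k
    rw [AddMonoidHom.mem_ker, Submodule.mem_toAddSubgroup, LinearMap.mem_range]
    simp only [g, AddMonoidHom.mk'_apply, h.leaf_eq_zero_iff, Prod.mk.injEq]
    constructor
    · rintro ⟨a, b, e1, _⟩
      refine ⟨![a, b], ?_⟩
      rw [div_eq_iff h1] at e1
      have := h.int_inj (m := k 0) (n := k 1) (m' := m * a + -n * σ * b)
        (n' := n * a + (m + n * r) * b) (by
          rw [e1]; push_cast; linear_combination (n * b) * h.sq_eq)
      rw [hAv]
      ext i; fin_cases i <;> simp [this.1, this.2]
    · rintro ⟨k', rfl⟩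
      refine ⟨k' 0, k' 1, ?_, ?_⟩
      · rw [div_eq_iff h1, hAv]
        simp only [Matrix.cons_val_zero, Matrix.cons_val_one]
        push_cast; linear_combination (-n * k' 1) * h.sq_eq
      · rw [div_eq_iff h2, hAv]
        simp only [Matrix.cons_val_zero, Matrix.cons_val_one]
        push_cast; linear_combination (-n * k' 1) * h.conj_sq_eq
  rw [hfib, Set.ncard_image_of_injective _ (add_right_injective y₀), ← Nat.card_coe_set_eq]
  change Nat.card g.range = _
  rw [← AddSubgroup.index_ker, hker, ← hA, ← LinearMap.det_toLin']
  exact ((Submodule.natAbs_det_equiv _ (LinearEquiv.ofInjective _ hinj)).trans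
    (Submodule.cardQuot_apply _)).symm

theorem ae_ncard_coding {m n : ℤ} (hmn : (m, n) ≠ (0, 0)) :
    ∀ᵐ t : Torus2, {ε | ε ∈ symbolicCompactum l r σ ∧ coding l c m n ε = t}.ncard =
      (m * m + m * n * r + n * n * σ).natAbs := by
  have h1 := h.linear_ne_zero hmn
  have h2 := h.conj_linear_ne_zero hmn
  refine h.ae_torus_of_ae_leaf (Q := fun t => {ε | ε ∈ symbolicCompactum l r σ ∧
    coding l c m n ε = t}.ncard = (m * m + m * n * r + n * n * σ).natAbs) ?_
  -- All points of the fibre over `leaf` of w arise from w by a lattice translation and a division.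
  -- These are countably many conditions, each of full measure, so generically every point of the
  -- fibre has a unique code for the parameter 1.
  have hall : ∀ᵐ w : Fin 2 → ℝ, ∀ k : Fin 2 → ℤ, ∃! ε, ε ∈ symbolicCompactum l r σ ∧
      coding l c 1 0 ε = leaf l c ((w 0 + (k 0 + k 1 * l)) / (m + n * l),
        (w 1 + (k 0 + k 1 * c)) / (m + n * c)) := by
    refine ae_all_iff.2 fun k => ?_
    have := ae_mulVec (M := !![1 / (m + n * l), 0; 0, 1 / (m + n * c)]) (by
      rw [Matrix.det_fin_two_of]; simp [h1, h2]) h.ae_existsUnique_coding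
    have := (measurePreserving_add_right volume
      ![(k 0 : ℝ) + k 1 * l, (k 0 : ℝ) + k 1 * c]).quasiMeasurePreserving.ae this
    refine this.mono fun w hw => ?_
    simpa [Matrix.mulVec, dotProduct, Fin.sum_univ_two, div_eq_inv_mul] using hw
  refine hall.mono fun w hw => ?_
  rw [← h.ncard_fiber hmn (leaf l c (w 0, w 1))]
  have hgood (y : Torus2) (hy : toralMap (mulMatrix r σ m n) y = leaf l c (w 0, w 1)) :
      ∃! ε, ε ∈ symbolicCompactum l r σ ∧ coding l c 1 0 ε = y := by
    obtain ⟨⟨p, q⟩, rfl⟩ := h.leaf_surjective y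
    rw [h.toralMap_mulMatrix, h.leaf_eq_iff] at hy
    obtain ⟨a, b, hab⟩ := hy
    have e1 := congrArg Prod.fst hab
    have e2 := congrArg Prod.snd hab
    simp only [Prod.mk_add_mk] at e1 e2
    have := hw ![a, b]
    simp only [Matrix.cons_val_zero, Matrix.cons_val_one, ← e1, ← e2] at this
    rwa [mul_div_cancel_left₀ _ h1, mul_div_cancel_left₀ _ h2] at this
  refine Set.ncard_congr (fun ε _ => coding l c 1 0 ε) (fun ε hε => ?_) (fun ε ε' hε hε' he => ?_)
    fun y hy => ?_
  · exact (h.coding_eq_toralMap m n ε).symm.trans hε.2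
  · have := hgood _ ((h.coding_eq_toralMap m n ε).symm.trans hε.2)
    exact this.unique ⟨hε.1, rfl⟩ ⟨hε'.1, he.symm⟩
  · obtain ⟨ε, hε, he⟩ := (hgood y hy).exists
    refine ⟨ε, ⟨hε, ?_⟩, he⟩
    rw [h.coding_eq_toralMap, he]
    exact hy

theorem ae_existsUnique_of_norm_eq_one {m n : ℤ}
    (hN : (m * m + m * n * r + n * n * σ).natAbs = 1) :
    ∀ᵐ t : Torus2, ∃! ε, ε ∈ symbolicCompactum l r σ ∧ coding l c m n ε = t := by
  have hmn : (m, n) ≠ (0, 0) := by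
    rintro h0
    simp only [Prod.mk.injEq] at h0
    simp [h0.1, h0.2] at hN
  refine (h.ae_ncard_coding hmn).mono fun t ht => ?_
  rw [hN, Set.ncard_eq_one] at ht
  obtain ⟨ε, hε⟩ := ht
  rw [Set.ext_iff] at hε
  exact ⟨ε, (hε ε).2 rfl, fun ε' hε' => (hε ε').1 hε'⟩

end QuadUnit

/-! ### Equivariant maps and homoclinic points -/

/-- The sequence with the single nonzero digit `1` at place `k`. -/
def singleSeq (l : ℝ) (k : ℤ) : PrimarySet l :=
  ⟨Pi.single k 1, mem_of_finite_support ((Set.finite_singleton k).subset Pi.support_single_subset)⟩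

theorem singleSeq_apply (l : ℝ) (k j : ℤ) : (singleSeq l k).1 j = if j = k then 1 else 0 :=
  Pi.single_apply k 1 j

theorem shift_singleSeq (l : ℝ) (k : ℤ) : shift (singleSeq l (k + 1)) = singleSeq l k := by
  ext j
  simp [shift, singleSeq_apply]

theorem sum_singleSeq_apply {l : ℝ} (ε : ℤ → ℕ) (s : Finset ℤ) (j : ℤ) :
    (∑ k ∈ s, ε k • singleSeq l k).1 j = if j ∈ s then ε j else 0 := by
  rw [show (∑ k ∈ s, ε k • singleSeq l k).1 = ∑ k ∈ s, (ε k • singleSeq l k).1 from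
    map_sum (PrimarySet l).subtype _ s, Finset.sum_apply]
  have (k : ℤ) : (ε k • singleSeq l k).1 j = if j = k then ε k else 0 := by
    change ε k • (singleSeq l k).1 j = _
    rw [singleSeq_apply]; split_ifs <;> simp
  simp only [this, Finset.sum_ite_eq]

/-- A map that is additive, equivariant and continuous on dominated sets. -/
structure IsEquivariant {l : ℝ} (r : ℕ) (σ : ℤ) (φ : PrimarySet l → Torus2) : Prop where
  map_add : ∀ ε ε', φ (ε + ε') = φ ε + φ ε'
  continuousOn : ∀ w : PrimarySet l, ContinuousOn φ {ε | ∀ n, ε.1 n ≤ w.1 n}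
  map_shift : ∀ ε, φ (shift ε) = toralMap (companionMatrix r σ) (φ ε)

namespace IsEquivariant

variable {l : ℝ} {r : ℕ} {σ : ℤ} {φ : PrimarySet l → Torus2} (hφ : IsEquivariant r σ φ)
include hφ

theorem map_zero : φ 0 = 0 := by
  have := hφ.map_add 0 0
  simpa using this

theorem map_sum_singleSeq (ε : ℤ → ℕ) (s : Finset ℤ) :
    φ (∑ k ∈ s, ε k • singleSeq l k) = ∑ k ∈ s, ε k • φ (singleSeq l k) := by
  have := map_sum (AddMonoidHom.mk' φ hφ.map_add) (fun k => ε k • singleSeq l k) s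
  simpa only [map_nsmul] using! this

/-- Single digits escaping to infinity tend to 0 coordinatewise inside the set dominated by the
constant sequence 1, where φ is continuous. -/
theorem tendsto_singleSeq (f : ℕ → ℤ) (hf : Function.Injective f) (hl : 1 < l) :
    Tendsto (fun k => φ (singleSeq l (f k))) atTop (𝓝 0) := by
  have h0 : ContinuousWithinAt φ {ε | ∀ n, ε.1 n ≤ (constSeq hl 1).1 n} 0 :=
    hφ.continuousOn _ 0 fun n => Nat.zero_le _
  rw [← hφ.map_zero]
  refine h0.tendsto.comp (tendsto_nhdsWithin_iff.2 ⟨tendsto_subtype_rng.2 (tendsto_pi_nhds.2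
    fun j => ?_), Eventually.of_forall fun k n => ?_⟩)
  · refine tendsto_const_nhds.congr' ?_
    have : ∀ᶠ k in atTop, f k ≠ j := by
      rw [← Nat.cofinite_eq_atTop]
      exact (Set.finite_singleton j).preimage hf.injOn |>.eventually_cofinite_notMem
    filter_upwards [this] with k hk
    rw [singleSeq_apply, if_neg (Ne.symm hk)]
    rfl
  · rw [singleSeq_apply]
    simp only [constSeq]
    split_ifs <;> simp

end IsEquivariant

namespace QuadUnit

variable {r : ℕ} {σ : ℤ} {l c : ℝ} (h : QuadUnit r σ l c)
include h

/-- Points near `0` have small coordinates. -/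
theorem exists_small_leaf (t : Torus2) :
    ∃ p : ℝ × ℝ, leaf l c p = t ∧ |p.1| ≤ (l + 1) * ‖t‖ ∧ |p.2| ≤ (l + 1) * ‖t‖ := by
  have hrep (a : UnitAddCircle) : ∃ x : ℝ, (x : UnitAddCircle) = a ∧ |x| = ‖a‖ := by
    obtain ⟨y, rfl⟩ := QuotientAddGroup.mk_surjective a
    refine ⟨y - round y, ?_, (UnitAddCircle.norm_eq (x := y)).symm⟩
    rw [AddCircle.coe_sub, (AddCircle.coe_eq_zero_iff 1 (x := (round y : ℝ))).2
      ⟨round y, by simp⟩, sub_zero]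
  choose z hz1 hz2 using fun i => hrep (t i)
  have hl := h.one_lt
  have hc := abs_lt.1 h.abs_conj_lt_one
  have hn (i : Fin 2) := abs_le.1 ((hz2 i).le.trans (norm_le_pi_norm t i))
  have h0 := hn 0
  have h1 := hn 1
  have hbound (a : ℝ) (ha1 : -l ≤ a) (ha2 : a ≤ l) : |a * z 0 + z 1| ≤ (l + 1) * ‖t‖ := by
    have h2 : |a * z 0| ≤ l * ‖t‖ := by
      rw [abs_mul]
      exact mul_le_mul (abs_le.2 ⟨ha1, ha2⟩) (abs_le.2 h0) (abs_nonneg _) (by linarith)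
    calc |a * z 0 + z 1| ≤ |a * z 0| + |z 1| := abs_add_le _ _
      _ ≤ l * ‖t‖ + ‖t‖ := add_le_add h2 (abs_le.2 h1)
      _ = _ := by ring
  refine ⟨(l * z 0 + z 1, c * z 0 + z 1), ?_, hbound l (by linarith) le_rfl,
    hbound c (by linarith) (by linarith)⟩
  rw [h.leaf_mulVec]
  ext i; exact hz1 i

/-- The lattice `{(m + n l, m + n c)}` is discrete. -/
theorem exists_lattice_gap : ∃ δ > 0, ∀ m n : ℤ, |(m : ℝ) + n * l| < δ → |(m : ℝ) + n * c| < δ →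
    m = 0 ∧ n = 0 := by
  have hs := h.sub_pos
  refine ⟨min 1 ((l - c) / 2), by positivity, fun m n h1 h2 => ?_⟩
  rw [lt_min_iff] at h1 h2
  have hn : n = 0 := by
    by_contra hn
    have h3 : (1 : ℝ) ≤ |(n : ℝ)| := by exact_mod_cast Int.one_le_abs hn
    have h4 : |(n : ℝ)| * (l - c) < l - c := by
      rw [← abs_of_pos hs, ← abs_mul, abs_of_pos hs]
      calc |(n : ℝ) * (l - c)| = |((m : ℝ) + n * l) - (m + n * c)| := by congr 1; ring
        _ ≤ |(m : ℝ) + n * l| + |(m : ℝ) + n * c| := abs_sub _ _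
        _ < l - c := by linarith [h1.2, h2.2]
    nlinarith
  subst hn
  refine ⟨?_, rfl⟩
  have : |(m : ℝ)| < 1 := by simpa using h1.1
  have : |m| < 1 := by exact_mod_cast this
  exact Int.abs_lt_one_iff.1 this

/-- Small coordinates along a sequence tending to `0`. -/
theorem exists_small_leaf_seq {u : ℕ → Torus2} (hu : Tendsto u atTop (𝓝 0)) :
    ∃ p : ℕ → ℝ × ℝ, (∀ k, leaf l c (p k) = u k) ∧ Tendsto (fun k => (p k).1) atTop (𝓝 0) ∧
      Tendsto (fun k => (p k).2) atTop (𝓝 0) := by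
  choose p hp h1 h2 using fun k => h.exists_small_leaf (u k)
  have h0 : Tendsto (fun k => (l + 1) * ‖u k‖) atTop (𝓝 0) := by
    simpa using hu.norm.const_mul (l + 1)
  exact ⟨p, hp, squeeze_zero_norm h1 h0, squeeze_zero_norm h2 h0⟩

/-- If the coordinates of `u k` and those of the image of `u k` are small, the toral automorphism
acts on them linearly. -/
theorem eventually_linear {p q : ℕ → ℝ × ℝ}
    (hp1 : Tendsto (fun k => (p k).1) atTop (𝓝 0)) (hp2 : Tendsto (fun k => (p k).2) atTop (𝓝 0))
    (hq1 : Tendsto (fun k => (q k).1) atTop (𝓝 0)) (hq2 : Tendsto (fun k => (q k).2) atTop (𝓝 0))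
    (hpq : ∀ k, toralMap (companionMatrix r σ) (leaf l c (p k)) = leaf l c (q k)) :
    ∀ᶠ k in atTop, (q k).1 = l * (p k).1 ∧ (q k).2 = c * (p k).2 := by
  obtain ⟨δ, hδ, hgap⟩ := h.exists_lattice_gap
  have h1 : Tendsto (fun k => |(q k).1 - l * (p k).1|) atTop (𝓝 0) := by
    simpa using (hq1.sub (hp1.const_mul l)).abs
  have h2 : Tendsto (fun k => |(q k).2 - c * (p k).2|) atTop (𝓝 0) := by
    simpa using (hq2.sub (hp2.const_mul c)).abs
  filter_upwards [h1.eventually_lt_const hδ, h2.eventually_lt_const hδ] with k hk1 hk2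
  have := hpq k
  rw [h.toralMap_companion, eq_comm, h.leaf_eq_iff] at this
  obtain ⟨m, n, hmn⟩ := this
  rw [hmn] at hk1 hk2
  simp only [Prod.mk_add_mk, add_sub_cancel_left] at hk1 hk2
  obtain ⟨rfl, rfl⟩ := hgap m n hk1 hk2
  rw [hmn]; simp

/-- The homoclinic point of an equivariant map. -/
theorem exists_homoclinic {φ : PrimarySet l → Torus2} (hφ : IsEquivariant r σ φ) :
    ∃ m n : ℤ, φ (singleSeq l 0) = leaf l c ((m : ℝ) + n * l, 0) := by
  have hl := h.pos
  have hstep (k : ℤ) : toralMap (companionMatrix r σ) (φ (singleSeq l (k + 1))) =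
      φ (singleSeq l k) := by rw [← hφ.map_shift, shift_singleSeq]
  have hq := inv_lt_one_of_one_lt₀ h.one_lt
  have hpow : Tendsto (fun j : ℕ => l⁻¹ ^ j) atTop (𝓝 0) :=
    tendsto_pow_atTop_nhds_zero_of_lt_one (inv_nonneg.2 hl.le) hq
  -- The forward orbit tends to 0, so its small lifts eventually transform linearly; an expanding
  -- coordinate other than 0 could not stay small. The backward orbit is treated in the same way
  -- with the contracting coordinate.
  obtain ⟨K, y, hy⟩ : ∃ (K : ℕ) (y : ℝ), φ (singleSeq l (-K)) = leaf l c (0, y) := by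
    obtain ⟨p, hp, hp1, hp2⟩ := h.exists_small_leaf_seq
      (hφ.tendsto_singleSeq (fun k : ℕ => -(k : ℤ)) (fun a b hab => by simpa using hab) h.one_lt)
    have hlin := h.eventually_linear hp1 hp2 ((tendsto_add_atTop_iff_nat 1).2 hp1)
      ((tendsto_add_atTop_iff_nat 1).2 hp2) fun k => by
        rw [hp, hp, ← hstep (-((k + 1 : ℕ) : ℤ))]
        simp
    obtain ⟨K, hK⟩ := eventually_atTop.1 hlin
    have hj (j : ℕ) : (p K).1 = l⁻¹ ^ j * (p (K + j)).1 := by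
      induction j with
      | zero => simp
      | succ j ih =>
        rw [ih, ← add_assoc, (hK (K + j) (by omega)).1, pow_succ]
        field_simp
    have h0 : (p K).1 = 0 := by
      have ht : Tendsto (fun j : ℕ => l⁻¹ ^ j * (p (K + j)).1) atTop (𝓝 (0 * 0)) := by
        refine hpow.mul ?_
        simpa only [add_comm K] using (tendsto_add_atTop_iff_nat K).2 hp1
      simp only [← hj, mul_zero] at ht
      exact tendsto_nhds_unique tendsto_const_nhds ht
    exact ⟨K, (p K).2, by rw [← hp K, ← h0]⟩
  obtain ⟨K', x, hx⟩ : ∃ (K' : ℕ) (x : ℝ), φ (singleSeq l K') = leaf l c (x, 0) := by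
    obtain ⟨p, hp, hp1, hp2⟩ := h.exists_small_leaf_seq
      (hφ.tendsto_singleSeq (fun k : ℕ => (k : ℤ)) (fun a b hab => by simpa using hab) h.one_lt)
    have hlin := h.eventually_linear ((tendsto_add_atTop_iff_nat 1).2 hp1)
      ((tendsto_add_atTop_iff_nat 1).2 hp2) hp1 hp2 fun k => by
        rw [hp, hp, ← hstep k]; push_cast; rfl
    obtain ⟨K, hK⟩ := eventually_atTop.1 hlin
    have hj (j : ℕ) : (p K).2 = c ^ j * (p (K + j)).2 := by
      induction j with
      | zero => simp
      | succ j ih =>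
        rw [ih, ← add_assoc, (hK (K + j) (by omega)).2]
        ring
    have h0 : (p K).2 = 0 := by
      have ht : Tendsto (fun j : ℕ => c ^ j * (p (K + j)).2) atTop (𝓝 (0 * 0)) := by
        refine (tendsto_pow_atTop_nhds_zero_of_abs_lt_one h.abs_conj_lt_one).mul ?_
        simpa only [add_comm K] using (tendsto_add_atTop_iff_nat K).2 hp2
      simp only [← hj, mul_zero] at ht
      exact tendsto_nhds_unique tendsto_const_nhds ht
    exact ⟨K, (p K).1, by rw [← hp K, ← h0]⟩
  have hiter (k : ℤ) (j : ℕ) : (toralMap (companionMatrix r σ))^[j] (φ (singleSeq l (k + j))) =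
      φ (singleSeq l k) := by
    induction j generalizing k with
    | zero => simp
    | succ j ih =>
      rw [Function.iterate_succ_apply, ← ih k, ← hstep (k + j)]
      congr 4; push_cast; ring
  -- The value lies on both leaves through 0; its two lifts differ by a lattice vector, whose
  -- expanding coordinate is the required m + nl.
  have e1 : φ (singleSeq l 0) = leaf l c (l ^ K' * x, 0) := by
    have := hiter 0 K'
    rw [zero_add, hx, h.iterate_toralMap_companion, mul_zero] at this
    exact this.symm
  have e2 : φ (singleSeq l 0) = leaf l c (0, y / c ^ K) := by
    refine h.toralMap_companion_injective.iterate K ?_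
    have := hiter (-K) K
    rw [neg_add_cancel, hy] at this
    rw [this, h.iterate_toralMap_companion, mul_zero,
      mul_div_cancel₀ _ (pow_ne_zero K h.conj_ne_zero)]
  obtain ⟨m, n, hmn⟩ := (h.leaf_eq_iff _ _).1 (e1.symm.trans e2)
  refine ⟨m, n, ?_⟩
  rw [e1, show l ^ K' * x = m + n * l by simpa using congrArg Prod.fst hmn]

/-- Equivariant maps are the coding maps. -/
theorem exists_eq_coding {φ : PrimarySet l → Torus2} (hφ : IsEquivariant r σ φ) :
    ∃ m n : ℤ, φ = coding l c m n := by
  obtain ⟨m, n, h0⟩ := h.exists_homoclinic hφ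
  have hl := h.pos.ne'
  have hstep (k : ℤ) : toralMap (companionMatrix r σ) (φ (singleSeq l (k + 1))) =
      φ (singleSeq l k) := by rw [← hφ.map_shift, shift_singleSeq]
  have hk (k : ℤ) : φ (singleSeq l k) = leaf l c ((m + n * l) * l ^ (-k), 0) := by
    induction k with
    | zero => simpa using h0
    | succ k ih =>
      apply h.toralMap_companion_injective
      rw [hstep, ih, h.toralMap_companion]
      congr 2
      · simp only
        rw [neg_add, zpow_add₀ hl, zpow_neg_one]
        field_simp
      · simp
    | pred k ih =>
      rw [← hstep, sub_add_cancel, ih, h.toralMap_companion]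
      congr 2
      · simp only
        rw [neg_sub, sub_eq_add_neg, zpow_add₀ hl, zpow_one]
        ring
      · simp
  refine ⟨m, n, funext fun ε => ?_⟩
  refine tendsto_nhds_unique ?_ (h.tendsto_coding m n ε)
  -- The truncations of ε converge to ε and are dominated by ε itself, so φ is determined by its
  -- values on single digits.
  have hlim : Tendsto (fun N : ℕ => φ (∑ k ∈ Finset.Icc (-(N : ℤ)) N, ε.1 k • singleSeq l k)) atTop
      (𝓝 (φ ε)) := by
    refine (hφ.continuousOn ε ε fun _ => le_rfl).tendsto.comp (tendsto_nhdsWithin_iff.2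
      ⟨tendsto_subtype_rng.2 (tendsto_pi_nhds.2 fun j => ?_), Eventually.of_forall fun N j => ?_⟩)
    · refine tendsto_const_nhds.congr' ?_
      filter_upwards [eventually_ge_atTop j.natAbs] with N hN
      rw [sum_singleSeq_apply, if_pos]
      rw [Finset.mem_Icc]; omega
    · rw [sum_singleSeq_apply]
      split_ifs <;> simp
  refine hlim.congr fun N => ?_
  rw [hφ.map_sum_singleSeq]
  have : ((m + n * l) * ∑ k ∈ Finset.Icc (-(N : ℤ)) N, (ε.1 k : ℝ) * l ^ (-k), (0 : ℝ)) =
      ∑ k ∈ Finset.Icc (-(N : ℤ)) N, ε.1 k • ((m + n * l) * l ^ (-k), (0 : ℝ)) := by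
    simp only [Prod.smul_mk, smul_zero, nsmul_eq_mul]
    rw [← prod_mk_sum, Finset.sum_const_zero, Finset.mul_sum]
    congr 1
    exact Finset.sum_congr rfl fun k _ => by ring
  rw [this, map_sum]
  exact Finset.sum_congr rfl fun k _ => by rw [map_nsmul, hk]

end QuadUnit

/-! ### Which digits a total set can have -/

theorem LexLess.trans {a b c : ℕ → ℕ} (hab : LexLess a b) (hbc : LexLess b c) : LexLess a c := by
  obtain ⟨n, hn, hn'⟩ := hab
  obtain ⟨m, hm, hm'⟩ := hbc
  rcases lt_trichotomy n m with hlt | rfl | hlt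
  · exact ⟨n, (hm' n hlt) ▸ hn, fun k hk => (hn' k hk).trans (hm' k (hk.trans hlt))⟩
  · exact ⟨n, hn.trans hm, fun k hk => (hn' k hk).trans (hm' k hk)⟩
  · exact ⟨m, (hn' m hlt).symm ▸ hm, fun k hk => (hn' k (hk.trans hlt)).trans (hm' k hk)⟩

theorem LexLess.of_head {a b : ℕ → ℕ} (h : a 0 < b 0) : LexLess a b :=
  ⟨0, h, fun _ hm => absurd hm (Nat.not_lt_zero _)⟩

theorem LexLess.of_second {a b : ℕ → ℕ} (h0 : a 0 ≤ b 0) (h1 : a 1 < b 1) : LexLess a b := by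
  rcases h0.lt_or_eq with h0 | h0
  · exact .of_head h0
  · refine ⟨1, h1, fun m hm => ?_⟩
    obtain rfl : m = 0 := by omega
    exact h0

/-- This is the Cayley–Hamilton theorem for the companion matrix, the source of all carries between
digits. -/
theorem toralMap_companion_sq (r : ℕ) (σ : ℤ) (t : Torus2) :
    toralMap (companionMatrix r σ) (toralMap (companionMatrix r σ) t) + σ • t =
      r • toralMap (companionMatrix r σ) t := by
  ext i
  fin_cases i <;> (simp [toralMap, companionMatrix, Fin.sum_univ_two] <;> module)

/-- The word `(r-1) (r-2)^j (r-1)` at the places `0, …, j + 1`. -/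
def blockFun (r j : ℕ) (n : ℤ) : ℕ :=
  if n = 0 ∨ n = j + 1 then r - 1 else if 0 < n ∧ n ≤ j then r - 2 else 0

theorem finite_support_blockFun (r j : ℕ) : (Function.support (blockFun r j)).Finite := by
  refine (Set.finite_Icc (0 : ℤ) (j + 1)).subset fun n hn => ?_
  simp only [Function.mem_support, blockFun] at hn
  rw [Set.mem_Icc]
  split_ifs at hn <;> omega

/-- The word `(r-1) (r-2)^j (r-1)` as an element of the primary set. -/
def blockSeq (l : ℝ) (r j : ℕ) : PrimarySet l :=
  ⟨blockFun r j, mem_of_finite_support (finite_support_blockFun r j)⟩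

theorem sum_range_singleSeq_apply (l : ℝ) (a N : ℕ) (d n : ℤ) :
    (∑ i ∈ Finset.range N, a • singleSeq l (i + d)).1 n = if d ≤ n ∧ n < d + N then a else 0 := by
  induction N with
  | zero =>
    rw [Finset.range_zero, Finset.sum_empty, if_neg (by simp)]; rfl
  | succ N ih =>
    rw [Finset.sum_range_succ]
    change (∑ i ∈ Finset.range N, a • singleSeq l (i + d)).1 n + a • (singleSeq l (N + d)).1 n = _
    rw [ih, singleSeq_apply]
    push_cast
    split_ifs <;> first | omega | simp

namespace IsEquivariant

variable {l : ℝ} {r : ℕ} {σ : ℤ} {φ : PrimarySet l → Torus2} (hφ : IsEquivariant r σ φ)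
include hφ

theorem singleSeq_relation (k : ℤ) :
    φ (singleSeq l (k - 1)) + σ • φ (singleSeq l (k + 1)) = r • φ (singleSeq l k) := by
  have h1 : φ (singleSeq l k) = toralMap (companionMatrix r σ) (φ (singleSeq l (k + 1))) := by
    rw [← hφ.map_shift, shift_singleSeq]
  have h2 : φ (singleSeq l (k - 1)) = toralMap (companionMatrix r σ) (φ (singleSeq l k)) := by
    rw [← hφ.map_shift]
    conv_rhs => rw [← sub_add_cancel k 1, shift_singleSeq]
  rw [h2, h1, toralMap_companion_sq]

theorem map_nsmul (a : ℕ) (ε : PrimarySet l) : φ (a • ε) = a • φ ε :=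
  (AddMonoidHom.mk' φ hφ.map_add).map_nsmul a ε

theorem map_sum {ι : Type*} (s : Finset ι) (f : ι → PrimarySet l) :
    φ (∑ i ∈ s, f i) = ∑ i ∈ s, φ (f i) :=
  _root_.map_sum (AddMonoidHom.mk' φ hφ.map_add) f s

variable {X : Set (PrimarySet l)} (hX : IsTotalSet X)
  (hinj : Set.InjOn φ {ε | ε ∈ X ∧ (Function.support ε.1).Finite})
include hX hinj

/-- By the carry rule the word r 1 at places 0, 1 and the digit 1 at place −1 have the same image.
If some tail of ε exceeded r 1 0 0 …, totality would put both finite sequences into X, against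
injectivity. The tail r 1 0 0 … itself is not excluded, whence the second alternative. -/
theorem digits_of_neg (hσ : σ = -1) (hr : 1 ≤ r) {ε : PrimarySet l} (hε : ε ∈ X) (n : ℤ) :
    ε.1 n ≤ r ∧ (ε.1 n = r → ε.1 (n + 1) = 0 ∨ ∀ k : ℤ, n + 2 ≤ k → ε.1 k = 0) := by
  let f : PrimarySet l := r • singleSeq l 0 + singleSeq l 1
  have hf (k : ℤ) : f.1 k = (if k = 0 then r else 0) + if k = 1 then 1 else 0 := by
    change r • (singleSeq l 0).1 k + (singleSeq l 1).1 k = _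
    simp only [singleSeq_apply]
    split_ifs <;> simp
  suffices H : ¬ LexLess (fun j : ℕ => f.1 (0 + j)) (fun j : ℕ => ε.1 (n + j)) by
    have h1 : ε.1 n ≤ r := by
      by_contra hlt
      refine H (.of_head ?_)
      simp [hf]; omega
    refine ⟨h1, fun hn => or_iff_not_imp_left.2 fun h0 => ?_⟩
    by_contra hk
    push Not at hk
    obtain ⟨k, hk, hk0⟩ := hk
    have hne : ε.1 (n + 1) = 1 := by
      by_contra hne
      refine H (.of_second ?_ ?_)
      · simp [hf, hn]
      · simp [hf]; omega
    have hex : ∃ j : ℕ, 2 ≤ j ∧ ε.1 (n + j) ≠ 0 :=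
      ⟨(k - n).toNat, by omega, by rwa [show n + ((k - n).toNat : ℤ) = k by omega]⟩
    classical
    obtain ⟨a1, a2⟩ := Nat.find_spec hex
    refine H ⟨Nat.find hex, ?_, fun j hj => ?_⟩
    · simp only [hf]
      rw [if_neg (by omega), if_neg (by omega)]
      omega
    · have := Nat.find_min hex hj
      simp only [hf]
      rcases Nat.lt_or_ge j 2 with h2 | h2
      · interval_cases j
        · simp [hn]
        · simp [hne]
      · rw [if_neg (by omega), if_neg (by omega)]
        by_contra hne'
        exact this ⟨h2, fun h0 => hne' (by rw [h0])⟩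
  intro H
  have htail (k : ℤ) (hk0 : f.1 k ≤ 1 ∨ f.1 k < r) (hk1 : f.1 (k + 1) = 0) :
      LexLess (fun j : ℕ => f.1 (k + j)) (fun j : ℕ => f.1 (0 + j)) := by
    refine .of_second ?_ ?_
    · simp only [hf 0, Nat.cast_zero, add_zero]
      simp; omega
    · simp [hk1, hf 1]
  have hfX : f ∈ X := by
    refine hX ε hε f ⟨n, fun k => ?_⟩
    rcases eq_or_ne k 0 with rfl | hk
    · exact H
    refine LexLess.trans ?_ H
    rcases eq_or_ne k (-1) with rfl | hk'
    · refine .of_head ?_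
      simp [hf]; omega
    · refine htail k ?_ ?_
      · left; rw [hf, if_neg hk]; split_ifs <;> simp
      · rw [hf, if_neg (by omega), if_neg (by omega)]
  have hgX : singleSeq l (-1) ∈ X := by
    refine hX ε hε _ ⟨n, fun k => LexLess.trans ?_ H⟩
    rcases eq_or_ne k (-1) with rfl | hk
    · refine .of_second ?_ ?_
      · simp [singleSeq_apply, hf]; omega
      · simp [singleSeq_apply, hf]
    · refine .of_head ?_
      simp [singleSeq_apply, hf, hk]; omega
  have hfin : (Function.support f.1).Finite := by
    refine (Set.finite_Icc (0 : ℤ) 1).subset fun k hk => ?_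
    rw [Function.mem_support, hf] at hk
    rw [Set.mem_Icc]
    split_ifs at hk <;> omega
  have hgfin : (Function.support (singleSeq l (-1)).1).Finite :=
    (Set.finite_singleton (-1)).subset Pi.support_single_subset
  have heq : φ f = φ (singleSeq l (-1)) := by
    have := hφ.singleSeq_relation 0
    rw [hφ.map_add, hφ.map_nsmul, ← this, hσ]
    simp
  have := congrArg (fun ε : PrimarySet l => ε.1 (-1)) (hinj ⟨hfX, hfin⟩ ⟨hgX, hgfin⟩ heq)
  simp [hf, singleSeq_apply] at this

/-- By carries the block at places 0, …, j + 1 has the same image as the two digits 1 at places −1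
and j + 2. A tail exceeding the block would put both finite sequences into X. -/
theorem not_lexLess_blockFun (hσ : σ = 1) (hr : 3 ≤ r) {ε : PrimarySet l} (hε : ε ∈ X) (n : ℤ)
    (j : ℕ) : ¬ LexLess (fun i : ℕ => blockFun r j (0 + i)) (fun i : ℕ => ε.1 (n + i)) := by
  intro H
  have hfX : blockSeq l r j ∈ X := by
    refine hX ε hε _ ⟨n, fun k => ?_⟩
    rcases eq_or_ne k 0 with rfl | hk
    · exact H
    refine LexLess.trans ?_ H
    rcases eq_or_ne k (j + 1) with rfl | hk'
    · refine .of_second ?_ ?_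
      · simp [blockSeq, blockFun]
      · simp only [blockSeq, blockFun]
        split_ifs <;> omega
    · refine .of_head ?_
      simp only [blockSeq, blockFun]
      split_ifs <;> omega
  let g : PrimarySet l := singleSeq l (-1) + singleSeq l (j + 2)
  have hg (k : ℤ) : g.1 k = (if k = -1 then 1 else 0) + if k = j + 2 then 1 else 0 := by
    change (singleSeq l (-1)).1 k + (singleSeq l (j + 2)).1 k = _
    simp only [singleSeq_apply]
  have hgX : g ∈ X := by
    refine hX ε hε _ ⟨n, fun k => LexLess.trans (.of_head ?_) H⟩
    simp only [hg, blockFun]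
    split_ifs <;> omega
  have hgfin : (Function.support g.1).Finite := by
    refine (Set.finite_Icc (-1 : ℤ) (j + 2)).subset fun k hk => ?_
    rw [Function.mem_support, hg] at hk
    rw [Set.mem_Icc]
    split_ifs at hk <;> omega
  -- The sum of the carry relations at places 0, …, j + 1: the left neighbours and the right
  -- neighbours together account for r at each of these places.
  have hsum : blockSeq l r j + (∑ i ∈ Finset.range (j + 2), 1 • singleSeq l (i + -1) +
      ∑ i ∈ Finset.range (j + 2), 1 • singleSeq l (i + 1)) =
      g + ∑ i ∈ Finset.range (j + 2), r • singleSeq l (i + 0) := by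
    ext k
    change (blockSeq l r j).1 k + ((∑ i ∈ Finset.range (j + 2), 1 • singleSeq l (i + -1)).1 k +
      (∑ i ∈ Finset.range (j + 2), 1 • singleSeq l (i + 1)).1 k) =
      g.1 k + (∑ i ∈ Finset.range (j + 2), r • singleSeq l (i + 0)).1 k
    rw [sum_range_singleSeq_apply, sum_range_singleSeq_apply, sum_range_singleSeq_apply, hg]
    simp only [blockSeq, blockFun]
    push_cast
    split_ifs <;> omega
  have heq : φ (blockSeq l r j) = φ g := by
    have h1 := congrArg φ hsum
    simp only [hφ.map_add (blockSeq l r j), hφ.map_add g, hφ.map_sum,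
      hφ.map_nsmul, ← Finset.sum_add_distrib] at h1
    refine add_right_cancel (h1.trans ?_)
    congr 1
    refine Finset.sum_congr rfl fun i _ => ?_
    have := hφ.singleSeq_relation i
    rw [hσ] at this
    rw [add_zero, ← this]
    simp [sub_eq_add_neg, hφ.map_add]
  have := congrArg (fun ε : PrimarySet l => ε.1 (-1))
    (hinj ⟨hfX, finite_support_blockFun r j⟩ ⟨hgX, hgfin⟩ heq)
  simp only [hg, blockSeq, blockFun] at this
  split_ifs at this <;> omega

theorem mem_symbolicCompactum_of_pos (hσ : σ = 1) (hr : 3 ≤ r) {ε : PrimarySet l} (hε : ε ∈ X) :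
    ε ∈ symbolicCompactum l r σ := by
  refine ⟨fun h => by omega, fun _ => ⟨fun n => ?_, fun n j => ?_⟩⟩
  · by_contra hn
    refine hφ.not_lexLess_blockFun hX hinj hσ hr hε n 0 (.of_head ?_)
    simp [blockFun]; omega
  · rintro ⟨a1, a2, a3⟩
    -- The comparison is with the block that is one place longer: it still has r − 2 where the block
    -- in ε ends with r − 1.
    refine hφ.not_lexLess_blockFun hX hinj hσ hr hε n (j + 1) ⟨j + 1, ?_, fun i hi => ?_⟩
    · have : ε.1 (n + ((j + 1 : ℕ) : ℤ)) + 1 = r := by rw [← a3]; push_cast; ring_nf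
      simp only [blockFun]
      split_ifs <;> omega
    · rcases Nat.eq_zero_or_pos i with rfl | hi0
      · simp [blockFun]; omega
      · have := a2 i hi0 (by omega)
        simp only [blockFun]
        split_ifs <;> omega

end IsEquivariant

/-! ### The parameter of a bijective coding is a unit -/

namespace QuadUnit

variable {r : ℕ} {σ : ℤ} {l c : ℝ} (h : QuadUnit r σ l c)
include h

theorem isEquivariant_coding (m n : ℤ) : IsEquivariant r σ (coding l c m n) :=
  ⟨h.coding_add m n, h.continuousOn_coding m n, h.coding_shift m n⟩

theorem fut_mem_quadInts {ε : PrimarySet l} {N : ℤ} (hN : ∀ k, N ≤ k → ε.1 k = 0) (n : ℤ) :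
    fut l ε.1 n ∈ quadInts l := by
  have hfar (n : ℤ) (hn : N ≤ n) : fut l ε.1 n = 0 :=
    (tsum_congr fun k => by rw [hN _ (by omega)]; simp).trans tsum_zero
  suffices H : ∀ (j : ℕ) (n : ℤ), N ≤ n + j → fut l ε.1 n ∈ quadInts l from
    H (N - n).toNat n (by omega)
  intro j
  induction j with
  | zero => exact fun n hn => ⟨(0, 0), by simp [hfar n (by simpa using hn)]⟩
  | succ j ih =>
    intro n hn
    obtain ⟨⟨a, b⟩, hab⟩ := ih (n + 1) (by push_cast at hn; omega)
    refine h.mem_quadInts_of_mul ⟨(ε.1 (n + 1) + a, b), ?_⟩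
    rw [fut_rec h.pos.ne' ε.2, ← hab]
    push_cast; ring

/-- Members of a total set on which the coding is injective for finite sequences. -/
theorem mem_symbolicCompactum_or {φ : PrimarySet l → Torus2} (hφ : IsEquivariant r σ φ)
    {X : Set (PrimarySet l)} (hX : IsTotalSet X)
    (hinj : Set.InjOn φ {ε | ε ∈ X ∧ (Function.support ε.1).Finite}) {ε : PrimarySet l}
    (hε : ε ∈ X) : ε ∈ symbolicCompactum l r σ ∨ fut l ε.1 0 ∈ quadInts l := by
  rcases h.cases with ⟨hσ, hr⟩ | ⟨hσ, hr⟩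
  · have hd := hφ.digits_of_neg hX hinj hσ hr hε
    rw [or_iff_not_imp_right]
    refine fun hq => ⟨fun _ n => ⟨(hd n).1, fun hn => ((hd n).2 hn).resolve_right fun h0 => ?_⟩,
      fun h1 => by omega⟩
    exact hq (h.fut_mem_quadInts h0 0)
  · exact Or.inl (hφ.mem_symbolicCompactum_of_pos hX hinj hσ hr hε)

theorem image_symbolicCompactum_eq_univ {m n : ℤ} {X : Set (PrimarySet l)} (hXc : IsClosed X)
    (hX : IsTotalSet X)
    (hinj : Set.InjOn (coding l c m n) {ε | ε ∈ X ∧ (Function.support ε.1).Finite})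
    (hsurj : coding l c m n '' X = Set.univ) :
    coding l c m n '' (X ∩ symbolicCompactum l r σ) = Set.univ := by
  have hcl : IsClosed (coding l c m n '' (X ∩ symbolicCompactum l r σ)) :=
    (h.isCompact_image_coding m n (hXc.inter (isClosed_symbolicCompactum l r σ))
      Set.inter_subset_right).isClosed
  -- Exceptional sequences have images on countably many contracting lines, a null set. The image of
  -- the others is thus closed with null complement, and an open null set is empty.
  let C : Set ℝ := Set.image2 (fun x y => (m + n * l) * x + y) (quadInts l) (quadInts l)
  have hC : C.Countable := (countable_quadInts l).image2 (countable_quadInts l) _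
  have hae : ∀ᵐ t : Torus2, t ∉ (coding l c m n '' (X ∩ symbolicCompactum l r σ))ᶜ := by
    refine h.ae_torus_of_ae_leaf ((ae_notMem_countable 0 hC).mono fun w hw => ?_)
    rw [Set.notMem_compl_iff]
    obtain ⟨ε, hε, he⟩ := (Set.ext_iff.1 hsurj (leaf l c (w 0, w 1))).2 trivial
    refine ⟨ε, ⟨hε, ?_⟩, he⟩
    refine (h.mem_symbolicCompactum_or (h.isEquivariant_coding m n) hX hinj hε).resolve_right
      fun hq => hw ?_
    rw [coding, eq_comm, h.leaf_eq_iff] at he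
    obtain ⟨a, b, hab⟩ := he
    exact ⟨_, hq, _, mem_quadInts l a b, (congrArg Prod.fst hab).symm⟩
  have h0 := (hcl.isOpen_compl.measure_eq_zero_iff volume).1 (measure_eq_zero_iff_ae_notMem.2 hae)
  exact Set.compl_empty_iff.1 h0

/-- If a coding admits a bijective arithmetic coding, its parameter is a unit. -/
theorem norm_eq_one_of_bijective {m n : ℤ} {X : Set (PrimarySet l)} (hXc : IsClosed X)
    (hXs : ∀ ε, shift ε ∈ X ↔ ε ∈ X) (hX : IsTotalSet X)
    (hinj : Set.InjOn (coding l c m n) {ε | ε ∈ X ∧ (Function.support ε.1).Finite})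
    (hsurj : coding l c m n '' X = Set.univ)
    (huniq : ∃ t, ∃! ε, ε ∈ X ∧ coding l c m n ε = t) :
    (m * m + m * n * r + n * n * σ).natAbs = 1 := by
  have hmn : (m, n) ≠ (0, 0) := by
    rintro h0
    simp only [Prod.mk.injEq] at h0
    obtain ⟨rfl, rfl⟩ := h0
    obtain ⟨ε, -, he⟩ := (Set.ext_iff.1 hsurj (leaf l c (1, 0))).2 trivial
    have : leaf l c (1, 0) = 0 := by
      rw [← he, coding]
      simp only [Int.cast_zero, zero_mul, add_zero, neg_zero]
      exact map_zero _
    obtain ⟨a, b, hab⟩ := (h.leaf_eq_zero_iff _).1 this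
    obtain ⟨rfl, rfl⟩ := h.conj_eq_zero_of_eq_zero (congrArg Prod.snd hab).symm
    simpa using congrArg Prod.fst hab
  let Y := X ∩ symbolicCompactum l r σ
  have hYsurj : coding l c m n '' Y = Set.univ :=
    h.image_symbolicCompactum_eq_univ hXc hX hinj hsurj
  let F := coding l c 1 0 '' Y
  have hF : IsClosed F :=
    (h.isCompact_image_coding 1 0 (hXc.inter (isClosed_symbolicCompactum l r σ))
      Set.inter_subset_right).isClosed
  let K := {y | toralMap (mulMatrix r σ m n) y = 0}
  have hN : m * m + m * n * r + n * n * σ ≠ 0 := by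
    intro h0
    have := h.norm_eq m n
    rw [h0] at this
    exact mul_ne_zero (h.linear_ne_zero hmn) (h.conj_linear_ne_zero hmn) (by simpa using this)
  have hK : K.Finite := Set.finite_of_ncard_ne_zero (by
    rw [h.ncard_fiber hmn]; simpa using hN)
  have hFT : ∀ t ∈ F, toralMap (companionMatrix r σ) t ∈ F := by
    rintro _ ⟨ε, hε, rfl⟩
    exact ⟨shift ε, ⟨(hXs ε).2 hε.1, (shift_mem_symbolicCompactum ε).2 hε.2⟩,
      h.coding_shift 1 0 ε⟩
  -- Translates of the closed set F by the finite kernel cover the torus, since multiplication by m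
  -- + nl maps F onto everything; the Baire theorem gives an interior point.
  have hint : (interior F).Nonempty := by
    have : Countable K := hK.countable.to_subtype
    have hcover : ⋃ κ : K, Homeomorph.subRight κ.1 ⁻¹' F = Set.univ := by
      rw [Set.eq_univ_iff_forall]
      intro t
      obtain ⟨ε, hε, he⟩ := (Set.ext_iff.1 hYsurj (toralMap (mulMatrix r σ m n) t)).2 trivial
      rw [h.coding_eq_toralMap] at he
      refine Set.mem_iUnion.2 ⟨⟨t - coding l c 1 0 ε, ?_⟩, ε, hε, ?_⟩
      · have := (toralHom (mulMatrix r σ m n)).map_sub t (coding l c 1 0 ε)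
        exact this.trans (sub_eq_zero.2 he.symm)
      · simp
    obtain ⟨κ, hκ⟩ := nonempty_interior_of_iUnion_of_closed
      (fun κ : K => hF.preimage (Homeomorph.subRight κ.1).continuous) hcover
    rw [← Homeomorph.preimage_interior] at hκ
    obtain ⟨t, ht⟩ := hκ
    exact ⟨_, ht⟩
  have hFu := h.eq_univ_of_interior hF hFT hint
  -- Every point of the fibre over t has a code in X, and each such code is a preimage of t.
  -- Uniqueness of the preimage leaves one point in the fibre, whose size is the norm.
  obtain ⟨t, ε, -, hε⟩ := huniq
  rw [← h.ncard_fiber hmn t, Set.ncard_eq_one]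
  have hy (y : Torus2) (hy : toralMap (mulMatrix r σ m n) y = t) : y = coding l c 1 0 ε := by
    obtain ⟨ε', hε', rfl⟩ := (Set.ext_iff.1 hFu y).2 trivial
    rw [← h.coding_eq_toralMap] at hy
    rw [hε ε' ⟨hε'.1, hy⟩]
  obtain ⟨y, hy'⟩ := h.toralMap_mulMatrix_surjective hmn t
  refine ⟨coding l c 1 0 ε, Set.eq_singleton_iff_unique_mem.2 ⟨?_, hy⟩⟩
  rw [← hy y hy']
  exact hy'

end QuadUnit

/-! ### Conclusion for the companion matrix -/

theorem quadUnit_companionMatrix {r : ℕ} {σ : ℤ} (h : (σ = -1 ∧ 1 ≤ r) ∨ (σ = 1 ∧ 3 ≤ r)) :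
    QuadUnit r σ (eigenLam (companionMatrix r σ)) (eigenLamConj (companionMatrix r σ)) := by
  have := QuadUnit.of_sqrt h
  simpa [eigenLam, eigenLamConj, discrD, companionMatrix, Matrix.trace_fin_two,
    Matrix.det_fin_two] using this

theorem sqrt_discrD (r : ℕ) (σ : ℤ) : √(discrD (companionMatrix r σ)) =
    eigenLam (companionMatrix r σ) - eigenLamConj (companionMatrix r σ) := by
  rw [eigenLam, eigenLamConj]; ring

section

variable {r : ℕ} {σ : ℤ} {c : ℝ} (h : QuadUnit r σ (eigenLam (companionMatrix r σ)) c)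
include h

theorem isLMap_coding (m n : ℤ) :
    IsLMap r σ ((m + n * eigenLam (companionMatrix r σ)) / (eigenLam (companionMatrix r σ) - c))
      (coding _ c m n) := by
  intro ε
  refine (h.tendsto_coding m n ε).congr fun N => ?_
  generalize ∑ k ∈ Finset.Icc (-(N : ℤ)) N,
    (ε.1 k : ℝ) * eigenLam (companionMatrix r σ) ^ (-k) = S
  have hc := h.conj_eq
  generalize eigenLam (companionMatrix r σ) = l at *
  ext i
  fin_cases i <;> simp only [leaf_apply, Fin.zero_eta, Fin.mk_one, Matrix.cons_val_zero,
    Matrix.cons_val_one] <;> congr 1 <;> rw [hc] <;> ring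

theorem eq_coding_of_isLMap {m n : ℤ} {φ : PrimarySet (eigenLam (companionMatrix r σ)) → Torus2}
    (hφ : IsLMap r σ
      ((m + n * eigenLam (companionMatrix r σ)) / (eigenLam (companionMatrix r σ) - c)) φ) :
    φ = coding _ c m n :=
  funext fun ε => tendsto_nhds_unique (hφ ε) (isLMap_coding h m n ε)

/-- The bijective arithmetic codings are the maps `L_ξ` with `ξ = u / √D`, `u` a unit. -/
theorem exists_isBijectiveArithmeticCoding_iff
    (φ : PrimarySet (eigenLam (companionMatrix r σ)) → Torus2) :
    (∃ X, IsBijectiveArithmeticCoding (companionMatrix r σ) φ X) ↔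
      ∃ m n : ℤ, |((m : ℝ) + n * eigenLam (companionMatrix r σ)) * (m + n * c)| = 1 ∧
        φ = coding _ c m n := by
  have hnorm (m n : ℤ) : |((m : ℝ) + n * eigenLam (companionMatrix r σ)) * (m + n * c)| = 1 ↔
      (m * m + m * n * r + n * n * σ).natAbs = 1 := by
    rw [h.norm_eq]
    norm_cast
    rw [Int.abs_eq_natAbs]
    norm_cast
  constructor
  · rintro ⟨X, hX, huniq⟩
    obtain ⟨m, n, rfl⟩ := h.exists_eq_coding ⟨hX.map_add, hX.continuousOn, hX.map_shift⟩
    exact ⟨m, n, (hnorm m n).2 (h.norm_eq_one_of_bijective hX.isClosed hX.shift_invariant hX.total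
      hX.injOn_finite hX.surjective huniq.exists), rfl⟩
  · rintro ⟨m, n, hN, rfl⟩
    have hmn : (m, n) ≠ (0, 0) := by
      rintro h0
      simp only [Prod.mk.injEq] at h0
      simp [h0.1, h0.2] at hN
    exact ⟨_, h.isArithmeticCoding hmn, h.ae_existsUnique_of_norm_eq_one ((hnorm m n).1 hN)⟩

end

/-- For r = 3, σ = 1 the eigenvalue is the golden ratio plus 1, so both generate the same ring. Its
units are then covered by the case r = 1, σ = −1. -/
theorem quadUnit_goldenRatio : QuadUnit 1 (-1) Real.goldenRatio Real.goldenConj :=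
  ⟨Or.inl ⟨rfl, le_rfl⟩, Real.one_lt_goldenRatio, by simp,
    by simp, Real.goldenRatio_irrational⟩

theorem theorem2p2 (r : ℕ) (σ : ℤ) (h : (σ = -1 ∧ 1 ≤ r) ∨ (σ = 1 ∧ 3 ≤ r)) :
    -- a bijective arithmetic coding exists
    (∃ φ X, IsBijectiveArithmeticCoding (companionMatrix r σ) φ X) ∧
    -- the bijective arithmetic codings are exactly the maps `L_ξ` with `ξ = ±λ^k / √D`
    (¬ (r = 3 ∧ σ = 1) → ∀ φ,
      (∃ X, IsBijectiveArithmeticCoding (companionMatrix r σ) φ X) ↔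
        ∃ (s : ℝ) (k : ℤ), (s = 1 ∨ s = -1) ∧
          IsLMap r σ (s * eigenLam (companionMatrix r σ) ^ k /
            Real.sqrt (discrD (companionMatrix r σ))) φ) ∧
    -- in the exceptional case they are exactly the maps `L_ξ` with `ξ = ±θ^k / √D`
    (r = 3 ∧ σ = 1 → ∀ φ,
      (∃ X, IsBijectiveArithmeticCoding (companionMatrix r σ) φ X) ↔
        ∃ (s : ℝ) (k : ℤ), (s = 1 ∨ s = -1) ∧
          IsLMap r σ (s * Real.goldenRatio ^ k /
            Real.sqrt (discrD (companionMatrix r σ))) φ) ∧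
    -- for `ξ = (m + n λ) / √D ≠ 0`, the map `L_ξ` is `|D N(ξ)|`-to-one on the symbolic compactum
    (∀ m n : ℤ, (m, n) ≠ (0, 0) →
      ∀ ξ ξ' : ℝ,
        ξ = (m + n * eigenLam (companionMatrix r σ)) /
          Real.sqrt (discrD (companionMatrix r σ)) →
        ξ' = -(m + n * eigenLamConj (companionMatrix r σ)) /
          Real.sqrt (discrD (companionMatrix r σ)) →
        ∃ φ, IsLMap r σ ξ φ ∧
          ∀ᵐ x ∂(volume : Measure Torus2),
            (Set.ncard {ε | ε ∈ symbolicCompactum (eigenLam (companionMatrix r σ)) r σ ∧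
              φ ε = x} : ℝ) = |discrD (companionMatrix r σ) * (ξ * ξ')|) := by
  have hq := quadUnit_companionMatrix h
  have hsD : √(discrD (companionMatrix r σ)) ^ 2 = discrD (companionMatrix r σ) := by
    refine Real.sq_sqrt ?_
    by_contra hneg
    have := sqrt_discrD r σ
    rw [Real.sqrt_eq_zero_of_nonpos (not_le.1 hneg).le] at this
    linarith [hq.sub_pos]
  have hs := hq.sub_pos.ne'
  rw [sqrt_discrD] at *
  refine ⟨?_, fun hexc φ => ?_, ?_, fun m n hmn ξ ξ' hξ hξ' => ?_⟩
  · obtain ⟨X, hX⟩ := (exists_isBijectiveArithmeticCoding_iff hq (coding _ _ 1 0)).2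
      ⟨1, 0, by simp, rfl⟩
    exact ⟨_, X, hX⟩
  · rw [exists_isBijectiveArithmeticCoding_iff hq]
    constructor
    · rintro ⟨m, n, hN, rfl⟩
      obtain ⟨s, k, hs, hmn⟩ := hq.unit_eq_zpow hexc hN
      exact ⟨s, k, hs, hmn ▸ isLMap_coding hq m n⟩
    · rintro ⟨s, k, hs, hL⟩
      obtain ⟨m, n, h1, h2⟩ := hq.zpow_mem k
      have hone := hq.abs_zpow_mul_conj k
      rw [h1, h2] at hone
      rw [h1] at hL
      rcases hs with rfl | rfl
      · exact ⟨m, n, hone, eq_coding_of_isLMap hq (by simpa using hL)⟩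
      · refine ⟨-m, -n, ?_, eq_coding_of_isLMap hq ?_⟩
        · rw [← hone]; congr 1; push_cast; ring
        · convert hL using 2; push_cast; ring
  · rintro ⟨rfl, rfl⟩ φ
    have hg := quadUnit_goldenRatio
    have hsqrt : √(discrD (companionMatrix 3 1)) = √5 := by
      congr 1
      simp [discrD, companionMatrix, Matrix.trace_fin_two, Matrix.det_fin_two]
      norm_num
    have hl : eigenLam (companionMatrix 3 1) = Real.goldenRatio + 1 := by
      rw [eigenLam, hsqrt, Real.goldenRatio]
      simp [companionMatrix, Matrix.trace_fin_two]
      ring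
    have hc : eigenLamConj (companionMatrix 3 1) = Real.goldenConj + 1 := by
      rw [eigenLamConj, hsqrt, Real.goldenConj]
      simp [companionMatrix, Matrix.trace_fin_two]
      ring
    rw [exists_isBijectiveArithmeticCoding_iff hq]
    constructor
    · rintro ⟨m, n, hN, rfl⟩
      have e1 : (m : ℝ) + n * eigenLam (companionMatrix 3 1) =
          ((m + n : ℤ) : ℝ) + n * Real.goldenRatio := by rw [hl]; push_cast; ring
      have e2 : (m : ℝ) + n * eigenLamConj (companionMatrix 3 1) =
          ((m + n : ℤ) : ℝ) + n * Real.goldenConj := by rw [hc]; push_cast; ring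
      rw [e1, e2] at hN
      obtain ⟨s, k, hs, hmn⟩ := hg.unit_eq_zpow (by simp) hN
      exact ⟨s, k, hs, hmn ▸ e1 ▸ isLMap_coding hq m n⟩
    · rintro ⟨s, k, hs, hL⟩
      obtain ⟨m, n, h1, h2⟩ := hg.zpow_mem k
      have e1 : (m : ℝ) + n * Real.goldenRatio =
          ((m - n : ℤ) : ℝ) + n * eigenLam (companionMatrix 3 1) := by rw [hl]; push_cast; ring
      have e2 : (m : ℝ) + n * Real.goldenConj =
          ((m - n : ℤ) : ℝ) + n * eigenLamConj (companionMatrix 3 1) := by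
        rw [hc]; push_cast; ring
      have hone := hg.abs_zpow_mul_conj k
      rw [h1, h2, e1, e2] at hone
      rw [h1, e1] at hL
      rcases hs with rfl | rfl
      · exact ⟨m - n, n, hone, eq_coding_of_isLMap hq (by simpa only [one_mul] using hL)⟩
      · refine ⟨-(m - n), -n, ?_, eq_coding_of_isLMap hq ?_⟩
        · rw [← hone]; congr 1; push_cast; ring
        · convert hL using 2; push_cast; ring
  · refine ⟨coding _ _ m n, hξ ▸ isLMap_coding hq m n, (hq.ae_ncard_coding hmn).mono fun t ht => ?_⟩
    -- Conjugation changes the sign of √D, so D · ξ · ξ' is minus the norm of m + nl; hence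
    -- `abs_neg`.
    rw [ht, Nat.cast_natAbs, Int.cast_abs, ← hq.norm_eq, ← hsD, hξ, hξ', ← abs_neg]
    congr 1
    field_simp
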